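/- An instance of stochastic score classification consists of $n$ items and integer thresholds. Item $i\in[n]$ has an independent outcome $X_i\in\{0,1\}$ with $\Pr[X_i=1]=p_i\in[0,1]$, which is observed by probing $i$ at cost $c_i\in\mathbb{R}_{\ge 0}$, and an integer weight $w_i\in\mathbb{Z}$ (of either sign). The thresholds $\alpha_1<\alpha_2<\dots<\alpha_{B+1}$ define classes $I_j=\{\alpha_j,\dots,\alpha_{j+1}-1\}$, $j\in[B]$, such that every possible total weight $w(x)=\sum_{i=1}^n w_i x_i$, $x\in\{0,1\}^n$, satisfies $\alpha_1\le w(x)<\alpha_{B+1}$. The goal is to determine the class $f(X)$, i.e. the index $j$ with $w(X)\in I_j$. An adaptive policy is a decision tree in which the next probed item may depend on all previous outcomes and which announces the correct class $f(x)$ for every $x\in\{0,1\}^n$; its cost on an outcome vector is the total cost of the probes that it makes. A non-adaptive policy is a permutation of the items (a list): the items are probed in this order until the class is determined, i.e. until all completions $y\in\{0,1\}^n$ of the observed outcomes have the same class $f(y)$. There are absolute constants $C$, $K$, $d$ and one algorithm (a program of a unit-cost real RAM with exact real arithmetic and comparisons, no rounding, and addition, subtraction and comparison of integers) with the following property. On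 input $n$, $(p_i)$, $(c_i)$, $(w_i)$ (and without access to $B$ or the thresholds) the algorithm outputs a list of the $n$ items such that, for all $B$ and all thresholds $\alpha_1<\dots<\alpha_{B+1}$ as above simultaneously, the expected cost of the non-adaptive policy given by this list is at most $C$ times the expected cost of every adaptive policy, and hence of an optimal one. The running time of the algorithm is nearly linear in $n$: it is at most $$K\,(n+1)\,\bigl(\log(2+n+W+\Gamma)\bigr)^d,\qquad W=\sum_{i=1}^n |w_i|,$$ for every $\Gamma\ge 1$ that bounds the ratio of any two positive costs $c_i/c_j$. -/

import Mathlib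

noncomputable section

namespace SSC

/-! ### Score classification -/

/-- The part of an instance of stochastic score classification that does not concern the classes:
`n` independent items; item `i` has outcome `1` (`true`) with probability `p i`, nonnegative
probing cost `c i` and integer weight `w i` (of either sign). -/
structure Items (n : ℕ) where
  p : Fin n → ℝ
  c : Fin n → ℝ
  w : Fin n → ℤ
  p_nonneg : ∀ i, 0 ≤ p i
  p_le_one : ∀ i, p i ≤ 1
  c_nonneg : ∀ i, 0 ≤ c i

/-- An outcome vector `X`: one bit for every item. -/
abbrev Outcome (n : ℕ) := Fin n → Bool

namespace Items

variable {n : ℕ} (I : Items n)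

/-- Probability of the outcome vector `x` under independent Bernoulli items. -/
def prob (x : Outcome n) : ℝ := ∏ i, if x i then I.p i else 1 - I.p i

/-- Expectation of a function of the outcome vector. -/
def expect (g : Outcome n → ℝ) : ℝ := ∑ x, I.prob x * g x

/-- Total weight `w(x) = ∑ i, w i * x i`. -/
def score (x : Outcome n) : ℤ := ∑ i, if x i then I.w i else 0

end Items

/-- The score `s` lies in class `j`, i.e. in `{α j, …, α (j+1) - 1}`. -/
def InClass {B : ℕ} (α : Fin (B + 1) → ℤ) (s : ℤ) (j : Fin B) : Prop :=
  α j.castSucc ≤ s ∧ s < α j.succ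

/-- Thresholds `α 0 < … < α B` whose `B` classes partition an integer interval
that contains the total weight of every outcome. -/
structure IsThresholds {n : ℕ} (I : Items n) {B : ℕ} (α : Fin (B + 1) → ℤ) : Prop where
  strictMono : StrictMono α
  cover : ∀ x, α 0 ≤ I.score x ∧ I.score x < α (Fin.last B)

/-! ### Adaptive policies -/

/-- An adaptive policy: stop and announce a class, or probe item `i` and continue with the first
policy if the outcome is `0` and with the second one if it is `1`. -/
inductive Policy (n B : ℕ) where
  | announce (j : Fin B) : Policy n B
  | probe (i : Fin n) (ifZero ifOne : Policy n B) : Policy n B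

namespace Policy

variable {n B : ℕ}

/-- The class announced on outcome vector `x`. -/
def output (x : Outcome n) : Policy n B → Fin B
  | announce j => j
  | probe i T₀ T₁ => if x i then output x T₁ else output x T₀

/-- The total cost of the probes made on outcome vector `x`. -/
def cost (I : Items n) (x : Outcome n) : Policy n B → ℝ
  | announce _ => 0
  | probe i T₀ T₁ => I.c i + if x i then cost I x T₁ else cost I x T₀

/-- The policy evaluates the score classification function. -/
def Correct (I : Items n) (α : Fin (B + 1) → ℤ) (T : Policy n B) : Prop :=
  ∀ x, InClass α (I.score x) (T.output x)

/-- Expected cost of an adaptive policy. -/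
def expectedCost (I : Items n) (T : Policy n B) : ℝ := I.expect fun x => T.cost I x

end Policy

/-! ### Non-adaptive policies -/

section NonAdaptive

variable {n B : ℕ} (I : Items n) (α : Fin (B + 1) → ℤ) (σ : Equiv.Perm (Fin n))

/-- After probing the first `k` items of the list `σ 0, σ 1, …` on outcome vector `x`, the class is
determined, whatever the outcomes of the remaining items are. -/
def Determined (x : Outcome n) (k : ℕ) : Prop :=
  ∃ j : Fin B, ∀ y : Outcome n,
    (∀ m : Fin n, (m : ℕ) < k → y (σ m) = x (σ m)) → InClass α (I.score y) j

open Classical in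
/-- Cost on outcome vector `x` of the non-adaptive policy that probes in the order
`σ 0, σ 1, …` and stops once the class is determined: item `σ k` is paid for exactly when the
class is not determined by the items before it. -/
def listCost (x : Outcome n) : ℝ :=
  ∑ k : Fin n, if Determined I α σ x k then 0 else I.c (σ k)

/-- Expected cost of the non-adaptive policy with list `σ`. -/
def listExpectedCost : ℝ := I.expect fun x => listCost I α σ x

end NonAdaptive

/-! ### A real RAM

Programs operate on arrays of natural numbers and arrays of real numbers, indexed by natural
numbers. A scalar variable is cell `0` of an array. Real cells support rational constants, exact
arithmetic and comparison; there is no rounding and no conversion of reals to integers. Natural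
numbers support constants, addition, truncated subtraction and comparison, and serve as addresses.
Every executed assignment and every evaluated test is one step. A program is a fixed finite text,
so this is the usual unit-cost time up to a factor depending on the program only. -/

namespace RAM

/-- Memory: `nat a i` and `real a i` are the contents of cell `i` of array `a`. -/
@[ext] structure Store where
  nat : ℕ → ℕ → ℕ
  real : ℕ → ℕ → ℝ

namespace Store

/-- Write `v` to cell `i` of the natural-number array `a`. -/
def writeNat (s : Store) (a i v : ℕ) : Store :=
  { s with nat := Function.update s.nat a (Function.update (s.nat a) i v) }

/-- Write `v` to cell `i` of the real array `a`. -/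
def writeReal (s : Store) (a i : ℕ) (v : ℝ) : Store :=
  { s with real := Function.update s.real a (Function.update (s.real a) i v) }

end Store

/-- Natural-number expressions. -/
inductive NExpr where
  | const (k : ℕ) : NExpr
  | read (a : ℕ) (i : NExpr) : NExpr
  | add (e f : NExpr) : NExpr
  | sub (e f : NExpr) : NExpr

def NExpr.eval (s : Store) : NExpr → ℕ
  | .const k => k
  | .read a i => s.nat a (i.eval s)
  | .add e f => e.eval s + f.eval s
  | .sub e f => e.eval s - f.eval s

/-- Real expressions (a quotient with denominator `0` has value `0`). -/
inductive RExpr where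
  | const (q : ℚ) : RExpr
  | read (a : ℕ) (i : NExpr) : RExpr
  | add (e f : RExpr) : RExpr
  | sub (e f : RExpr) : RExpr
  | mul (e f : RExpr) : RExpr
  | div (e f : RExpr) : RExpr

def RExpr.eval (s : Store) : RExpr → ℝ
  | .const q => (q : ℝ)
  | .read a i => s.real a (i.eval s)
  | .add e f => e.eval s + f.eval s
  | .sub e f => e.eval s - f.eval s
  | .mul e f => e.eval s * f.eval s
  | .div e f => e.eval s / f.eval s

/-- Tests. -/
inductive Test where
  | natLe (e f : NExpr) : Test
  | realLe (e f : RExpr) : Test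
  | neg (b : Test) : Test
  | conj (b d : Test) : Test

def Test.Holds (s : Store) : Test → Prop
  | .natLe e f => e.eval s ≤ f.eval s
  | .realLe e f => e.eval s ≤ f.eval s
  | .neg b => ¬ b.Holds s
  | .conj b d => b.Holds s ∧ d.Holds s

/-- Programs. -/
inductive Program where
  | nop : Program
  | setNat (a : ℕ) (i e : NExpr) : Program
  | setReal (a : ℕ) (i : NExpr) (e : RExpr) : Program
  | seq (P Q : Program) : Program
  | cond (b : Test) (P Q : Program) : Program
  | loop (b : Test) (P : Program) : Program

/-- `Run P s s' t`: started in memory `s`, the program `P` halts after exactly `t` steps,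
with memory `s'`. -/
inductive Run : Program → Store → Store → ℕ → Prop where
  | nop (s : Store) : Run .nop s s 1
  | setNat (a : ℕ) (i e : NExpr) (s : Store) :
      Run (.setNat a i e) s (s.writeNat a (i.eval s) (e.eval s)) 1
  | setReal (a : ℕ) (i : NExpr) (e : RExpr) (s : Store) :
      Run (.setReal a i e) s (s.writeReal a (i.eval s) (e.eval s)) 1
  | seq {P Q : Program} {s₀ s₁ s₂ : Store} {t u : ℕ} :
      Run P s₀ s₁ t → Run Q s₁ s₂ u → Run (.seq P Q) s₀ s₂ (t + u)
  | condTrue {b : Test} {P Q : Program} {s s' : Store} {t : ℕ} :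
      b.Holds s → Run P s s' t → Run (.cond b P Q) s s' (t + 1)
  | condFalse {b : Test} {P Q : Program} {s s' : Store} {t : ℕ} :
      ¬ b.Holds s → Run Q s s' t → Run (.cond b P Q) s s' (t + 1)
  | loopTrue {b : Test} {P : Program} {s₀ s₁ s₂ : Store} {t u : ℕ} :
      b.Holds s₀ → Run P s₀ s₁ t → Run (.loop b P) s₁ s₂ u → Run (.loop b P) s₀ s₂ (t + u + 1)
  | loopFalse {b : Test} {P : Program} {s : Store} :
      ¬ b.Holds s → Run (.loop b P) s s 1

end RAM

/-- Initial memory for the input `n, p, c, w`: the number `n` is in cell `0` of the natural-number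
array `0`; the probabilities, costs and weights are in the first `n` cells of the real arrays
`0`, `1` and `2`; all other cells are `0`. -/
def Items.input {n : ℕ} (I : Items n) : RAM.Store where
  nat a i := if a = 0 ∧ i = 0 then n else 0
  real a i :=
    if h : i < n then
      if a = 0 then I.p ⟨i, h⟩ else if a = 1 then I.c ⟨i, h⟩ else if a = 2 then I.w ⟨i, h⟩ else 0
    else 0

/-- The list `σ 0, …, σ (n - 1)` of items is in the first `n` cells of the natural-number
array `1`. -/
def OutputIs {n : ℕ} (s : RAM.Store) (σ : Equiv.Perm (Fin n)) : Prop :=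
  ∀ k : Fin n, s.nat 1 k = σ k

end SSC

end

/-! Fix a policy and truncate it at a budget D. Write every outcome as a gain on one of two sides:
it raises the lower bound on the total weight or decreases the upper bound. A set of items whose
observed gains dominate those of the truncated policy on both sides has determined the class
whenever the policy finished within D (`not_undetermined_of_gain`). No threshold enters this
comparison, so one list serves all thresholds.

To dominate on one side, items are collected by value: at scale θ, an item is valuable if D times
its mean gain, divided by θ and truncated at 1, is at least 1/16 of its cost. Scales are halved from
above the total absolute weight down to 1, and collecting stops once the cost exceeds 161D. Let θ be
the last scale at which nothing outside is valuable. The policy pays at most D, so its expected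
truncated gain outside the collected items is at most 1/16, and Markov's inequality bounds its
chance of gaining θ there (`expect_outside_le`). The collected items that it does not probe cost at
least 160D and are valuable at θ/2, so by an exponential moment bound they gain less than θ with
probability at most e^(-3) ≤ 1/16 (`expect_prod_le`, `exp_neg_le_prod`). If the scales run out
first, θ = 1 and integrality replaces the second bound. Each side thus fails with probability at
most 1/8, relative to the event that the class was still open (`Suitable.expect_le`).

With u the probability that the class is open before a phase and u' after it, u' ≤ Pr[cost > D] +
u/4 (`expect_undet_le`). A phase costs at most 324D while the class is open and the budget then
doubles. The factor 1/4 beats the doubling, and the potential inequality `Competitive` is preserved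
(`Competitive.phase`).

The algorithm sees only costs, weights and probabilities. It makes a logarithmic number of budgets
times a logarithmic number of scales of linear scans; Hoare triples with step bounds certify both
its output and its time. -/

noncomputable section

namespace SSC

/-! ### Expectation over independent items -/

variable {n : ℕ}

namespace Items

variable (I : Items n)

/-- The mean of a function of the outcome of item `e`. -/
def mean (e : Fin n) (f : Bool → ℝ) : ℝ := I.p e * f true + (1 - I.p e) * f false

/-- The function `h` of the outcome vector does not depend on item `e`. -/
def Ignores {β : Type*} (h : Outcome n → β) (e : Fin n) : Prop :=
  ∀ x b, h (Function.update x e b) = h x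

theorem prob_nonneg (x : Outcome n) : 0 ≤ I.prob x := by
  refine Finset.prod_nonneg fun i _ => ?_
  split_ifs
  · exact I.p_nonneg i
  · linarith [I.p_le_one i]

theorem expect_mono {g h : Outcome n → ℝ} (H : ∀ x, g x ≤ h x) : I.expect g ≤ I.expect h :=
  Finset.sum_le_sum fun x _ => mul_le_mul_of_nonneg_left (H x) (I.prob_nonneg x)

theorem expect_nonneg {g : Outcome n → ℝ} (H : ∀ x, 0 ≤ g x) : 0 ≤ I.expect g :=
  Finset.sum_nonneg fun x _ => mul_nonneg (I.prob_nonneg x) (H x)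

theorem expect_add (g h : Outcome n → ℝ) :
    I.expect (fun x => g x + h x) = I.expect g + I.expect h := by
  simp [expect, mul_add, Finset.sum_add_distrib]

theorem expect_const_mul (a : ℝ) (g : Outcome n → ℝ) :
    I.expect (fun x => a * g x) = a * I.expect g := by
  simp only [expect, Finset.mul_sum]
  exact Finset.sum_congr rfl fun x _ => by ring

theorem expect_mul_const (a : ℝ) (g : Outcome n → ℝ) :
    I.expect (fun x => g x * a) = I.expect g * a := by
  simp only [expect, Finset.sum_mul]
  exact Finset.sum_congr rfl fun x _ => by ring

theorem expect_sum {ι : Type*} (s : Finset ι) (g : ι → Outcome n → ℝ) :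
    I.expect (fun x => ∑ i ∈ s, g i x) = ∑ i ∈ s, I.expect (g i) := by
  simp only [expect, Finset.mul_sum]
  exact Finset.sum_comm

/-- Independence by pairing every `x` with its flip at `e`: the two probabilities share the factor
`q`, and each pair sums to `q x * h x` times the mean. Twice the expectation is computed, so that no
representatives of the pairs are needed. -/
theorem expect_mul_coord {e : Fin n} {h : Outcome n → ℝ} (hh : Ignores h e) (f : Bool → ℝ) :
    I.expect (fun x => h x * f (x e)) = I.expect h * I.mean e f := by
  set q : Outcome n → ℝ := fun x => ∏ i ∈ Finset.univ.erase e, if x i then I.p i else 1 - I.p i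
    with hq
  have hprob : ∀ x, I.prob x = (if x e then I.p e else 1 - I.p e) * q x := fun x =>
    (Finset.mul_prod_erase Finset.univ (fun i => if x i then I.p i else 1 - I.p i)
      (Finset.mem_univ e)).symm
  have hinv : Function.Involutive fun x : Outcome n => Function.update x e (!x e) := by
    intro x; simp
  have hqi : ∀ x b, q (Function.update x e b) = q x := by
    intro x b
    refine Finset.prod_congr rfl fun i hi => ?_
    rw [Function.update_of_ne (Finset.ne_of_mem_erase hi)]
  have key : ∀ f : Bool → ℝ,
      2 * I.expect (fun x => h x * f (x e)) = (∑ x, q x * h x) * I.mean e f := by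
    intro f
    have h1 : I.expect (fun x => h x * f (x e)) =
        ∑ x, (if !x e then I.p e else 1 - I.p e) * q x * (h x * f (!x e)) := by
      unfold expect
      rw [← Equiv.sum_comp (Function.Involutive.toPerm _ hinv)]
      refine Finset.sum_congr rfl fun x _ => ?_
      simp only [Function.Involutive.coe_toPerm, hprob, hqi, hh x, Function.update_self]
    rw [two_mul]
    nth_rewrite 2 [h1]
    unfold expect
    rw [← Finset.sum_add_distrib, Finset.sum_mul]
    refine Finset.sum_congr rfl fun x _ => ?_
    rw [hprob, mean]
    beta_reduce
    generalize x e = v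
    cases v <;> simp <;> ring
  have k1 := key f
  have k2 := key fun _ => 1
  simp only [mul_one] at k2
  have : I.mean e (fun _ => 1) = 1 := by simp [mean]
  rw [this, mul_one] at k2
  rw [← k2] at k1
  change I.expect (fun x => h x * f (x e)) = I.expect (fun x => h x) * I.mean e f
  linarith

theorem Ignores.mul {h k : Outcome n → ℝ} {e : Fin n} (hh : Ignores h e) (hk : Ignores k e) :
    Ignores (fun x => h x * k x) e := fun x b => by simp only [hh x b, hk x b]

theorem expect_mul_prod (S : Finset (Fin n)) {h : Outcome n → ℝ}
    (hh : ∀ e ∈ S, Ignores h e) (f : Fin n → Bool → ℝ) :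
    I.expect (fun x => h x * ∏ e ∈ S, f e (x e)) = I.expect h * ∏ e ∈ S, I.mean e (f e) := by
  induction S using Finset.induction_on with
  | empty => simp
  | insert a S ha ih =>
    have h1 : (fun x => h x * ∏ e ∈ insert a S, f e (x e)) =
        fun x => (h x * ∏ e ∈ S, f e (x e)) * f a (x a) := by
      funext x; rw [Finset.prod_insert ha]; ring
    rw [h1, I.expect_mul_coord (e := a) (h := fun x => h x * ∏ e ∈ S, f e (x e)),
      ih fun e he => hh e (Finset.mem_insert_of_mem he), Finset.prod_insert ha]
    · ring
    · refine (hh a (Finset.mem_insert_self a S)).mul fun x b => ?_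
      refine Finset.prod_congr rfl fun i hi => ?_
      rw [Function.update_of_ne]
      rintro rfl; exact ha hi

/-! ### Gains -/

/-- The outcome of item `e` that raises the lower bound (`b = true`) or decreases the upper bound
(`b = false`) on the total weight. -/
def favorable (b : Bool) (e : Fin n) : Bool := if 0 ≤ I.w e then b else !b

/-- The amount by which outcome `v` of item `e` improves the bound of side `b`. -/
def gain (b : Bool) (e : Fin n) (v : Bool) : ℤ := if v = I.favorable b e then |I.w e| else 0

/-- The probability of the favorable outcome. -/
def favProb (b : Bool) (e : Fin n) : ℝ := if I.favorable b e then I.p e else 1 - I.p e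

/-- The gain at scale `θ`, truncated at `1`. -/
def trunc (θ : ℝ) (e : Fin n) : ℝ := min (|(I.w e : ℝ)| / θ) 1

/-- Total absolute weight. -/
def absWeight : ℝ := ∑ e, |(I.w e : ℝ)|

/-- The mean of the truncated gain. -/
def rate (b : Bool) (θ : ℝ) (e : Fin n) : ℝ := I.favProb b e * I.trunc θ e

/-- The truncated gain of an outcome of item `e`. -/
def tgain (b : Bool) (θ : ℝ) (e : Fin n) (v : Bool) : ℝ :=
  if v = I.favorable b e then I.trunc θ e else 0

theorem gain_nonneg (b : Bool) (e : Fin n) (v : Bool) : 0 ≤ I.gain b e v := by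
  unfold gain; split_ifs <;> simp

theorem favProb_nonneg (b : Bool) (e : Fin n) : 0 ≤ I.favProb b e := by
  unfold favProb; split_ifs
  · exact I.p_nonneg e
  · linarith [I.p_le_one e]

theorem trunc_nonneg {θ : ℝ} (hθ : 0 < θ) (e : Fin n) : 0 ≤ I.trunc θ e :=
  le_min (by positivity) zero_le_one

theorem trunc_le_one (θ : ℝ) (e : Fin n) : I.trunc θ e ≤ 1 := min_le_right _ _

theorem trunc_anti {θ η : ℝ} (hθ : 0 < θ) (h : θ ≤ η) (e : Fin n) :
    I.trunc η e ≤ I.trunc θ e :=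
  min_le_min (div_le_div_of_nonneg_left (abs_nonneg _) hθ h) le_rfl

theorem rate_anti (b : Bool) {θ η : ℝ} (hθ : 0 < θ) (h : θ ≤ η) (e : Fin n) :
    I.rate b η e ≤ I.rate b θ e :=
  mul_le_mul_of_nonneg_left (I.trunc_anti hθ h e) (I.favProb_nonneg b e)

theorem mean_tgain (b : Bool) (θ : ℝ) (e : Fin n) :
    I.mean e (I.tgain b θ e) = I.rate b θ e := by
  unfold mean tgain rate favProb
  cases I.favorable b e <;> simp

theorem tgain_nonneg (b : Bool) {θ : ℝ} (hθ : 0 < θ) (e : Fin n) (v : Bool) :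
    0 ≤ I.tgain b θ e v := by
  unfold tgain; split_ifs
  · exact I.trunc_nonneg hθ e
  · exact le_rfl

theorem tgain_le_one (b : Bool) (θ : ℝ) (e : Fin n) (v : Bool) : I.tgain b θ e v ≤ 1 := by
  unfold tgain; split_ifs
  · exact I.trunc_le_one θ e
  · exact zero_le_one

theorem tgain_eq (b : Bool) (θ : ℝ) (e : Fin n) (v : Bool) :
    I.tgain b θ e v = min ((I.gain b e v : ℝ) / θ) 1 := by
  unfold tgain gain trunc; split_ifs <;> simp

theorem sum_tgain_le (b : Bool) {θ : ℝ} (S : Finset (Fin n)) (x : Outcome n) :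
    ∑ e ∈ S, I.tgain b θ e (x e) ≤ ((∑ e ∈ S, I.gain b e (x e) : ℤ) : ℝ) / θ := by
  push_cast
  rw [Finset.sum_div]
  exact Finset.sum_le_sum fun e _ => by rw [tgain_eq]; exact min_le_left _ _

/-- Either a single item reaches `θ` and already contributes 1, or no term is truncated and the sum
is the whole gain divided by `θ`. -/
theorem one_le_sum_tgain (b : Bool) {θ : ℝ} (hθ : 0 < θ) (S : Finset (Fin n)) (x : Outcome n)
    (h : θ ≤ ((∑ e ∈ S, I.gain b e (x e) : ℤ) : ℝ)) :
    1 ≤ ∑ e ∈ S, I.tgain b θ e (x e) := by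
  by_cases H : ∃ e ∈ S, θ ≤ I.gain b e (x e)
  · obtain ⟨e, he, h1⟩ := H
    calc (1 : ℝ) = I.tgain b θ e (x e) := by
          rw [tgain_eq, min_eq_right]; rwa [one_le_div hθ]
      _ ≤ _ := Finset.single_le_sum (f := fun e => I.tgain b θ e (x e))
          (fun i _ => I.tgain_nonneg b hθ i _) he
  · push Not at H
    have : ∑ e ∈ S, I.tgain b θ e (x e) = ((∑ e ∈ S, I.gain b e (x e) : ℤ) : ℝ) / θ := by
      push_cast
      rw [Finset.sum_div]
      refine Finset.sum_congr rfl fun e he => ?_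
      rw [tgain_eq, min_eq_left]
      rw [div_le_one hθ]; exact (H e he).le
    rw [this]; rwa [one_le_div hθ]

theorem sum_gain_le_absWeight (b : Bool) (S : Finset (Fin n)) (x : Outcome n) :
    ((∑ e ∈ S, I.gain b e (x e) : ℤ) : ℝ) ≤ I.absWeight := by
  push_cast
  calc ∑ e ∈ S, (I.gain b e (x e) : ℝ) ≤ ∑ e, (I.gain b e (x e) : ℝ) :=
        Finset.sum_le_sum_of_subset_of_nonneg (Finset.subset_univ _)
          fun i _ _ => by exact_mod_cast I.gain_nonneg b i _
    _ ≤ _ := Finset.sum_le_sum fun e _ => by unfold gain; split_ifs <;> simp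

theorem gain_add_gain (e : Fin n) (v : Bool) :
    I.gain true e v + I.gain false e v = |I.w e| := by
  unfold gain favorable; by_cases h : 0 ≤ I.w e <;> cases v <;> simp [h]

/-- The total weight is a constant plus the gain of side `true`. With `gain_add_gain` it is also a
constant minus the gain of side `false`, so gains control the weight from both sides. -/
theorem score_eq (x : Outcome n) :
    I.score x = ∑ e, min (I.w e) 0 + ∑ e, I.gain true e (x e) := by
  rw [← Finset.sum_add_distrib]
  refine Finset.sum_congr rfl fun e _ => ?_
  unfold gain favorable
  rcases le_or_gt 0 (I.w e) with h | h
  · cases x e <;> simp [h, abs_of_nonneg]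
  · cases x e <;> simp [not_le.2 h, h.le, abs_of_neg h]

end Items

end SSC

end

noncomputable section

namespace SSC

/-! ### Policies and suitable sets of items -/

variable {n : ℕ}

namespace Policy

variable {B : ℕ} (I : Items n)

/-- The items probed by a policy as long as its total cost stays within the budget `D`. -/
def probed (x : Outcome n) : Policy n B → ℝ → Finset (Fin n)
  | announce _, _ => ∅
  | probe i T₀ T₁, D =>
    if I.c i ≤ D then insert i (if x i then probed x T₁ (D - I.c i) else probed x T₀ (D - I.c i))
    else ∅

theorem cost_nonneg (x : Outcome n) (T : Policy n B) : 0 ≤ T.cost I x := by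
  induction T with
  | announce j => exact le_rfl
  | probe i T₀ T₁ h₀ h₁ =>
    unfold cost
    have := I.c_nonneg i
    split_ifs <;> linarith

theorem output_eq_of_agree {x y : Outcome n} {T : Policy n B} {D : ℝ} (hD : T.cost I x ≤ D)
    (h : ∀ i ∈ probed I x T D, y i = x i) : T.output y = T.output x := by
  induction T generalizing D with
  | announce j => rfl
  | probe i T₀ T₁ h₀ h₁ =>
    unfold cost at hD
    have hc : I.c i ≤ D := by
      have := cost_nonneg I x T₀
      have := cost_nonneg I x T₁
      split_ifs at hD <;> linarith
    rw [probed, if_pos hc] at h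
    have hi := h i (Finset.mem_insert_self _ _)
    unfold output
    rw [hi]
    split_ifs with hx
    · rw [if_pos hx] at hD h
      exact h₁ (D := D - I.c i) (by linarith) fun k hk => h k (Finset.mem_insert_of_mem hk)
    · rw [if_neg hx] at hD h
      exact h₀ (D := D - I.c i) (by linarith) fun k hk => h k (Finset.mem_insert_of_mem hk)

theorem sum_probed_le (x : Outcome n) (T : Policy n B) {D : ℝ} (hD : 0 ≤ D) :
    ∑ e ∈ probed I x T D, I.c e ≤ D := by
  induction T generalizing D with
  | announce j => simpa [probed] using hD
  | probe i T₀ T₁ h₀ h₁ =>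
    rw [probed]
    have ins : ∀ s : Finset (Fin n), ∑ e ∈ insert i s, I.c e ≤ I.c i + ∑ e ∈ s, I.c e := by
      intro s
      by_cases hs : i ∈ s
      · rw [Finset.insert_eq_of_mem hs]; linarith [I.c_nonneg i]
      · rw [Finset.sum_insert hs]
    split_ifs with hc hx
    · linarith [ins (probed I x T₁ (D - I.c i)), h₁ (D := D - I.c i) (by linarith)]
    · linarith [ins (probed I x T₀ (D - I.c i)), h₀ (D := D - I.c i) (by linarith)]
    · simpa using hD

theorem cost_le_of_mem_probed {x : Outcome n} {T : Policy n B} {D : ℝ} {e : Fin n} (hD : 0 ≤ D)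
    (he : e ∈ probed I x T D) : I.c e ≤ D :=
  (Finset.single_le_sum (f := I.c) (fun i _ => I.c_nonneg i) he).trans (sum_probed_le I x T hD)

/-- The run never looks at an unprobed item. Hence the event that exactly `Q` is probed is
independent of the items outside `Q`. -/
theorem probed_update (x : Outcome n) (T : Policy n B) (D : ℝ) {e : Fin n} (b : Bool)
    (he : e ∉ probed I x T D) : probed I (Function.update x e b) T D = probed I x T D := by
  induction T generalizing D with
  | announce j => rfl
  | probe i T₀ T₁ h₀ h₁ =>
    rw [probed] at he ⊢
    rw [probed]
    split_ifs at he ⊢ with hc hx hx' hx'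
    all_goals try simp only [Finset.mem_insert, not_or] at he
    all_goals try rw [Function.update_of_ne (Ne.symm he.1)] at hx
    · rw [h₁ _ he.2]
    · contradiction
    · contradiction
    · rw [h₀ _ he.2]
    · rfl

/-- Whether `e` gets probed is decided before its outcome is seen; this gives a Wald-type identity
for the gains of probed items. -/
theorem mem_probed_update (x : Outcome n) (T : Policy n B) (D : ℝ) (e : Fin n) (b : Bool) :
    e ∈ probed I (Function.update x e b) T D ↔ e ∈ probed I x T D := by
  constructor
  · intro h
    by_contra h'
    rw [probed_update I x T D b h'] at h
    exact h' h
  · intro h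
    by_contra h'
    have := probed_update I (Function.update x e b) T D (x e) h'
    rw [Function.update_idem, Function.update_eq_self] at this
    rw [this] at h
    exact h' h

end Policy

/-! ### Suitable sets and their two tail bounds -/

open Items Policy

variable {B : ℕ} (I : Items n)

/-- The set `S` of new items suits the budget `D` and side `b`, given the set `L` of items that
are already listed: at some scale `θ` no item outside is valuable, and either `S` is expensive and
all of its items are valuable at scale `θ / 2`, or `θ` is the smallest possible gain. -/
structure Suitable (D : ℝ) (b : Bool) (L S : Finset (Fin n)) : Prop where
  disj : Disjoint L S
  cost_le : ∑ e ∈ S, I.c e ≤ 162 * D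
  scale : ∃ θ : ℝ, 0 < θ ∧
    (I.absWeight < θ ∨ ∀ e, e ∉ L → e ∉ S → I.c e ≤ D → D * I.rate b θ e ≤ 1 / 16 * I.c e) ∧
    (θ = 1 ∨ 161 * D < ∑ e ∈ S, I.c e ∧ ∀ e ∈ S, 1 / 16 * I.c e ≤ D * I.rate b (θ / 2) e)

/-- Each probed item contributes its rate, which is at most its cost over `16 * D` because it is not
valuable; the probed costs sum to at most `D`. Items dearer than `D` are never probed within the
budget. The weight `g` is later the indicator that the class is still open. -/
theorem expect_outside_le {D : ℝ} (hD : 0 < D) (b : Bool) (θ : ℝ)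
    (R : Finset (Fin n))
    (hR : ∀ e ∈ R, I.c e ≤ D → D * I.rate b θ e ≤ 1 / 16 * I.c e) (T : Policy n B)
    {g : Outcome n → ℝ} (hg : ∀ x, 0 ≤ g x) (hgR : ∀ e ∈ R, Ignores g e) :
    I.expect (fun x => g x * ∑ e ∈ R ∩ probed I x T D, I.tgain b θ e (x e)) ≤
      1 / 16 * I.expect g := by
  have h1 : ∀ x, g x * ∑ e ∈ R ∩ probed I x T D, I.tgain b θ e (x e) =
      ∑ e ∈ R, (g x * if e ∈ probed I x T D then 1 else 0) * I.tgain b θ e (x e) := by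
    intro x
    rw [Finset.mul_sum, ← Finset.filter_mem_eq_inter, Finset.sum_filter]
    refine Finset.sum_congr rfl fun e _ => ?_
    split_ifs <;> simp
  simp only [h1]
  rw [I.expect_sum]
  have h2 : ∀ e ∈ R, I.expect (fun x => (g x * if e ∈ probed I x T D then 1 else 0) *
      I.tgain b θ e (x e)) ≤
      I.expect (fun x => (g x * if e ∈ probed I x T D then 1 else 0) * (I.c e / (16 * D))) := by
    intro e he
    rw [I.expect_mul_coord (e := e) (h := fun x => g x * if e ∈ probed I x T D then 1 else 0)
      (fun x v => by simp only [hgR e he x v, mem_probed_update]), mean_tgain,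
      I.expect_mul_const]
    by_cases hc : I.c e ≤ D
    · refine mul_le_mul_of_nonneg_left ?_ (I.expect_nonneg fun x => ?_)
      · rw [le_div_iff₀ (by positivity)]
        linarith [hR e he hc]
      · split_ifs <;> simp [hg x]
    · have : (fun x => g x * if e ∈ probed I x T D then (1 : ℝ) else 0) = fun _ => 0 := by
        funext x
        rw [if_neg fun h => hc (cost_le_of_mem_probed I hD.le h), mul_zero]
      rw [this]
      simp [expect]
  refine (Finset.sum_le_sum h2).trans ?_
  rw [← I.expect_sum, ← I.expect_const_mul]
  refine I.expect_mono fun x => ?_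
  have h3 : ∑ e ∈ R, (g x * if e ∈ probed I x T D then 1 else 0) * (I.c e / (16 * D)) =
      g x / (16 * D) * ∑ e ∈ R ∩ probed I x T D, I.c e := by
    rw [Finset.mul_sum, ← Finset.filter_mem_eq_inter, Finset.sum_filter]
    refine Finset.sum_congr rfl fun e _ => ?_
    split_ifs
    · field_simp
    · simp
  rw [h3]
  have h4 : ∑ e ∈ R ∩ probed I x T D, I.c e ≤ D :=
    (Finset.sum_le_sum_of_subset_of_nonneg Finset.inter_subset_right
      fun i _ _ => I.c_nonneg i).trans (sum_probed_le I x T hD.le)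
  calc g x / (16 * D) * ∑ e ∈ R ∩ probed I x T D, I.c e ≤ g x / (16 * D) * D :=
        mul_le_mul_of_nonneg_left h4 (div_nonneg (hg x) (by positivity))
    _ = 1 / 16 * g x := by field_simp

/-- Conditioned on the probed set, the unprobed items of `S` are still independent. Each factor has
mean at most `exp (-rate / 2)`, and the unprobed part of `S` is expensive, hence has a large total
rate. -/
theorem expect_prod_le {D : ℝ} (hD : 0 < D) (b : Bool) {θ : ℝ} (hθ : 0 < θ)
    (S : Finset (Fin n)) (hcost : 161 * D < ∑ e ∈ S, I.c e)
    (hS : ∀ e ∈ S, 1 / 16 * I.c e ≤ D * I.rate b θ e) (T : Policy n B)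
    {g : Outcome n → ℝ} (hg : ∀ x, 0 ≤ g x) (hgS : ∀ e ∈ S, Ignores g e) :
    I.expect (fun x => g x * ∏ e ∈ S \ probed I x T D, (1 - I.tgain b θ e (x e) / 2)) ≤
      Real.exp (-5) * I.expect g := by
  -- Split by the value `Q` of the probed set, so that the index set of the product no longer
  -- depends on `x`.
  have h1 : ∀ x, g x * ∏ e ∈ S \ probed I x T D, (1 - I.tgain b θ e (x e) / 2) =
      ∑ Q : Finset (Fin n), (g x * if probed I x T D = Q then 1 else 0) *
        ∏ e ∈ S \ Q, (1 - I.tgain b θ e (x e) / 2) := by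
    intro x
    rw [Finset.sum_eq_single (probed I x T D)]
    · simp
    · intro Q _ hQ
      simp [hQ.symm]
    · simp
  simp only [h1]
  rw [I.expect_sum]
  have h2 : ∀ Q : Finset (Fin n), I.expect (fun x => (g x * if probed I x T D = Q then 1 else 0) *
      ∏ e ∈ S \ Q, (1 - I.tgain b θ e (x e) / 2)) ≤
      I.expect (fun x => (g x * if probed I x T D = Q then 1 else 0) * Real.exp (-5)) := by
    intro Q
    rw [I.expect_mul_prod (S \ Q) (h := fun x => g x * if probed I x T D = Q then 1 else 0)
      (f := fun e v => 1 - I.tgain b θ e v / 2), I.expect_mul_const]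
    · by_cases hQ : ∃ x, probed I x T D = Q
      · obtain ⟨x, hx⟩ := hQ
        refine mul_le_mul_of_nonneg_left ?_ (I.expect_nonneg fun x => ?_)
        · have hm : ∀ e, I.mean e (fun v => 1 - I.tgain b θ e v / 2) = 1 - I.rate b θ e / 2 := by
            intro e; rw [← mean_tgain]; unfold mean; ring
          have hr1 : ∀ e, I.rate b θ e ≤ 1 := fun e => by
            refine mul_le_one₀ ?_ (I.trunc_nonneg hθ e) (I.trunc_le_one θ e)
            unfold favProb; split_ifs
            · exact I.p_le_one e
            · linarith [I.p_nonneg e]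
          calc ∏ e ∈ S \ Q, I.mean e (fun v => 1 - I.tgain b θ e v / 2)
              ≤ ∏ e ∈ S \ Q, Real.exp (-(I.rate b θ e / 2)) := by
                refine Finset.prod_le_prod (fun e _ => ?_) fun e _ => ?_
                · rw [hm]; linarith [hr1 e]
                · rw [hm]; linarith [Real.add_one_le_exp (-(I.rate b θ e / 2))]
            _ = Real.exp (∑ e ∈ S \ Q, -(I.rate b θ e / 2)) := (Real.exp_sum _ _).symm
            _ ≤ Real.exp (-5) := by
                refine Real.exp_le_exp.2 ?_
                have hq : ∑ e ∈ Q, I.c e ≤ D := hx ▸ sum_probed_le I x T hD.le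
                have hs : ∑ e ∈ S, I.c e ≤ ∑ e ∈ S \ Q, I.c e + ∑ e ∈ Q, I.c e := by
                  rw [← Finset.sum_sdiff (Finset.inter_subset_left : S ∩ Q ⊆ S),
                    Finset.sdiff_inter_self_left]
                  exact add_le_add le_rfl (Finset.sum_le_sum_of_subset_of_nonneg
                    Finset.inter_subset_right fun i _ _ => I.c_nonneg i)
                have hsum : ∑ e ∈ S \ Q, I.c e ≤ 32 * D * ∑ e ∈ S \ Q, I.rate b θ e / 2 := by
                  rw [Finset.mul_sum]
                  refine Finset.sum_le_sum fun e he => ?_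
                  linarith [hS e (Finset.mem_sdiff.1 he).1]
                -- More than 160D of cost remains outside `Q`, and each cost is at most 32D times
                -- half the rate: 160 / 32 = 5.
                have : 5 ≤ ∑ e ∈ S \ Q, I.rate b θ e / 2 := by
                  by_contra hlt
                  push Not at hlt
                  nlinarith
                rw [Finset.sum_neg_distrib]
                linarith
        · split_ifs <;> simp [hg x]
      · have : (fun x => g x * if probed I x T D = Q then (1 : ℝ) else 0) = fun _ => 0 := by
          funext x
          rw [if_neg fun h => hQ ⟨x, h⟩, mul_zero]
        rw [this]
        simp [expect]
    · intro e he x v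
      obtain ⟨heS, heQ⟩ := Finset.mem_sdiff.1 he
      have : probed I (Function.update x e v) T D = Q ↔ probed I x T D = Q := by
        constructor
        · intro h
          have h' := probed_update I (Function.update x e v) T D (x e) (h ▸ heQ)
          rw [Function.update_idem, Function.update_eq_self] at h'
          rw [h', h]
        · intro h
          rw [probed_update I x T D v (h ▸ heQ), h]
      simp only [hgS e heS x v, this]
  refine (Finset.sum_le_sum fun Q _ => h2 Q).trans ?_
  rw [← I.expect_sum, ← I.expect_const_mul]
  refine I.expect_mono fun x => ?_
  rw [← Finset.sum_mul, ← Finset.mul_sum]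
  simp [mul_comm]

/-- On `[0, 1]` one has `exp (-y) ≤ 1 - y / 2`, so a small total gain keeps the product large. This
turns `expect_prod_le` into a lower-tail bound. -/
theorem exp_neg_le_prod (b : Bool) {θ : ℝ} (hθ : 0 < θ) (S : Finset (Fin n)) (x : Outcome n)
    (h : ((∑ e ∈ S, I.gain b e (x e) : ℤ) : ℝ) ≤ 2 * θ) :
    Real.exp (-2) ≤ ∏ e ∈ S, (1 - I.tgain b θ e (x e) / 2) := by
  have hsum : ∑ e ∈ S, I.tgain b θ e (x e) ≤ 2 :=
    (I.sum_tgain_le b S x).trans (by rw [div_le_iff₀ hθ]; exact h)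
  calc Real.exp (-2) ≤ Real.exp (∑ e ∈ S, -I.tgain b θ e (x e)) := by
        refine Real.exp_le_exp.2 ?_
        rw [Finset.sum_neg_distrib]; linarith
    _ = ∏ e ∈ S, Real.exp (-I.tgain b θ e (x e)) := Real.exp_sum _ _
    _ ≤ _ := by
        refine Finset.prod_le_prod (fun e _ => (Real.exp_pos _).le) fun e _ => ?_
        set y := I.tgain b θ e (x e)
        have h0 : 0 ≤ y := I.tgain_nonneg b hθ e _
        have h1 : y ≤ 1 := I.tgain_le_one b θ e _
        have h2 : 1 + y ≤ Real.exp y := by linarith [Real.add_one_le_exp y]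
        rw [Real.exp_neg]
        calc (Real.exp y)⁻¹ ≤ (1 + y)⁻¹ := inv_anti₀ (by linarith) h2
          _ ≤ 1 - y / 2 := by
            rw [inv_le_iff_one_le_mul₀ (by linarith)]
            nlinarith

theorem exp_neg_three_le : Real.exp (-3) ≤ 1 / 16 := by
  have h : (2.7 : ℝ) ≤ Real.exp 1 := by linarith [Real.exp_one_gt_d9]
  have h3 : Real.exp 3 = Real.exp 1 ^ 3 := by rw [← Real.exp_nat_mul]; norm_num
  rw [Real.exp_neg, h3, one_div]
  refine inv_anti₀ (by norm_num) ?_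
  calc (16 : ℝ) ≤ 2.7 ^ 3 := by norm_num
    _ ≤ _ := by gcongr

open Classical in
/-- It is unlikely that a policy of budget `D` gains more from the items outside `L ∪ S` than
a suitable set `S` gains from the items that the policy does not probe. -/
theorem Suitable.expect_le {D : ℝ} (hD : 0 < D) {b : Bool} {L S : Finset (Fin n)}
    (h : Suitable I D b L S) (T : Policy n B) {g : Outcome n → ℝ} (hg : ∀ x, 0 ≤ g x)
    (hgL : ∀ e, e ∉ L → Ignores g e) :
    I.expect (fun x => g x *
      if ∑ e ∈ S \ probed I x T D, I.gain b e (x e) <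
        ∑ e ∈ (L ∪ S)ᶜ ∩ probed I x T D, I.gain b e (x e) then 1 else 0) ≤
      1 / 8 * I.expect g := by
  obtain ⟨θ, hθ, hout, hin⟩ := h.scale
  have hgS : ∀ e ∈ S, Ignores g e := fun e he =>
    hgL e (Finset.disjoint_right.1 h.disj he)
  have upper : I.expect (fun x => g x *
      if θ ≤ ((∑ e ∈ (L ∪ S)ᶜ ∩ probed I x T D, I.gain b e (x e) : ℤ) : ℝ) then 1 else 0) ≤
      1 / 16 * I.expect g := by
    rcases hout with hW | hout
    · have : (fun x => g x * if θ ≤ ((∑ e ∈ (L ∪ S)ᶜ ∩ probed I x T D, I.gain b e (x e) : ℤ) : ℝ)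
          then (1 : ℝ) else 0) = fun _ => 0 := by
        funext x
        rw [if_neg, mul_zero]
        exact not_le.2 ((I.sum_gain_le_absWeight b _ x).trans_lt hW)
      rw [this]
      have := I.expect_nonneg hg
      simpa [expect] using this
    · refine le_trans (I.expect_mono fun x => ?_) (expect_outside_le I hD b θ (L ∪ S)ᶜ ?_ T hg ?_)
      · refine mul_le_mul_of_nonneg_left ?_ (hg x)
        split_ifs with hx
        · exact I.one_le_sum_tgain b hθ _ x hx
        · exact Finset.sum_nonneg fun e _ => I.tgain_nonneg b hθ e _
      · intro e he
        simp only [Finset.mem_compl, Finset.mem_union, not_or] at he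
        exact hout e he.1 he.2
      · intro e he
        simp only [Finset.mem_compl, Finset.mem_union, not_or] at he
        exact hgL e he.1
  rcases hin with h1 | ⟨hcost, hin⟩
  · refine le_trans (I.expect_mono fun x => ?_)
      (upper.trans (mul_le_mul_of_nonneg_right (by norm_num) (I.expect_nonneg hg)))
    refine mul_le_mul_of_nonneg_left ?_ (hg x)
    split_ifs with hlt hle hle
    · exact le_rfl
    · exfalso
      have h0 : 0 ≤ ∑ e ∈ S \ probed I x T D, I.gain b e (x e) :=
        Finset.sum_nonneg fun e _ => I.gain_nonneg b e _
      apply hle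
      rw [h1]
      -- At `θ = 1` a strictly larger integer gain is at least 1, so `upper` alone suffices.
      exact_mod_cast Int.add_one_le_iff.2 (h0.trans_lt hlt)
    · exact zero_le_one
    · exact le_rfl
  · have lower := expect_prod_le I hD b (half_pos hθ) S hcost hin T hg hgS
    -- In the bad event either the policy gains at least `θ` outside, or the unprobed part of `S`
    -- gains less than `θ = 2 * (θ / 2)`; in the second case `exp 2` times the product is at least
    -- 1.
    have key : I.expect (fun x => g x *
        if ∑ e ∈ S \ probed I x T D, I.gain b e (x e) <
          ∑ e ∈ (L ∪ S)ᶜ ∩ probed I x T D, I.gain b e (x e) then 1 else 0) ≤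
        I.expect (fun x => g x *
          (if θ ≤ ((∑ e ∈ (L ∪ S)ᶜ ∩ probed I x T D, I.gain b e (x e) : ℤ) : ℝ) then 1 else 0) +
          Real.exp 2 *
            (g x * ∏ e ∈ S \ probed I x T D, (1 - I.tgain b (θ / 2) e (x e) / 2))) := by
      refine I.expect_mono fun x => ?_
      have hp : 0 ≤ ∏ e ∈ S \ probed I x T D, (1 - I.tgain b (θ / 2) e (x e) / 2) :=
        Finset.prod_nonneg fun e _ => by linarith [I.tgain_le_one b (θ / 2) e (x e)]
      have hp' := mul_nonneg (Real.exp_pos 2).le (mul_nonneg (hg x) hp)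
      split_ifs with hlt hle hle
      · linarith
      · push Not at hle
        have hlt' : ((∑ e ∈ S \ probed I x T D, I.gain b e (x e) : ℤ) : ℝ) <
            ((∑ e ∈ (L ∪ S)ᶜ ∩ probed I x T D, I.gain b e (x e) : ℤ) : ℝ) := by exact_mod_cast hlt
        have := exp_neg_le_prod I b (half_pos hθ) (S \ probed I x T D) x (by linarith)
        have h2 : 1 ≤ Real.exp 2 *
            ∏ e ∈ S \ probed I x T D, (1 - I.tgain b (θ / 2) e (x e) / 2) := by
          calc (1 : ℝ) = Real.exp 2 * Real.exp (-2) := by rw [← Real.exp_add]; simp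
            _ ≤ _ := by gcongr
        nlinarith [hg x]
      · linarith [hg x]
      · linarith
    refine key.trans ?_
    rw [I.expect_add, I.expect_const_mul]
    have h5 : Real.exp 2 * (Real.exp (-5) * I.expect g) ≤ 1 / 16 * I.expect g := by
      rw [← mul_assoc, ← Real.exp_add]
      norm_num
      have := exp_neg_three_le
      refine mul_le_mul_of_nonneg_right (by linarith) (I.expect_nonneg hg)
    have h6 := mul_le_mul_of_nonneg_left lower (Real.exp_pos 2).le
    linarith

end SSC

end

noncomputable section

namespace SSC

/-! ### Competitive lists -/

open Items Policy

variable {n B : ℕ} (I : Items n) (α : Fin (B + 1) → ℤ)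

/-- The outcomes of the items in `L` do not determine the class. -/
def Undetermined (L : Finset (Fin n)) (x : Outcome n) : Prop :=
  ¬ ∃ j : Fin B, ∀ y : Outcome n, (∀ i ∈ L, y i = x i) → InClass α (I.score y) j

open Classical in
/-- The indicator function of `Undetermined`. -/
def undet (L : Finset (Fin n)) (x : Outcome n) : ℝ := if Undetermined I α L x then 1 else 0

theorem undet_nonneg (L : Finset (Fin n)) (x : Outcome n) : 0 ≤ undet I α L x := by
  unfold undet; split_ifs <;> simp

variable {α} in
theorem Undetermined.mono {L M : Finset (Fin n)} (h : L ⊆ M) {x : Outcome n}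
    (hx : Undetermined I α M x) : Undetermined I α L x :=
  fun ⟨j, hj⟩ => hx ⟨j, fun y hy => hj y fun i hi => hy i (h hi)⟩

theorem undet_anti {L M : Finset (Fin n)} (h : L ⊆ M) (x : Outcome n) :
    undet I α M x ≤ undet I α L x := by
  unfold undet
  by_cases hM : Undetermined I α M x
  · rw [if_pos hM, if_pos (hM.mono I h)]
  · rw [if_neg hM]; split_ifs <;> simp

theorem undet_ignores {L : Finset (Fin n)} {e : Fin n} (he : e ∉ L) :
    Ignores (undet I α L) e := by
  intro x b
  have : Undetermined I α L (Function.update x e b) ↔ Undetermined I α L x := by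
    have h : ∀ i ∈ L, Function.update x e b i = x i := fun i hi => by
      rw [Function.update_of_ne]; rintro rfl; exact he hi
    unfold Undetermined
    refine not_congr (exists_congr fun j => forall_congr' fun y => imp_congr ?_ Iff.rfl)
    exact forall₂_congr fun i hi => by rw [h i hi]
  unfold undet
  by_cases h : Undetermined I α L x
  · rw [if_pos h, if_pos (this.2 h)]
  · rw [if_neg h, if_neg fun h' => h (this.1 h')]

variable {α}

/-- If a policy has classified `x` within its budget, then so has every set of items with at least
the same gain on both sides. -/
theorem not_undetermined_of_gain {T : Policy n B} (hT : T.Correct I α) {x : Outcome n} {D : ℝ}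
    (hcost : T.cost I x ≤ D) {L : Finset (Fin n)}
    (h : ∀ b, ∑ e ∈ probed I x T D, I.gain b e (x e) ≤ ∑ e ∈ L, I.gain b e (x e)) :
    ¬ Undetermined I α L x := by
  rw [Undetermined, not_not]
  refine ⟨T.output x, fun y hy => ?_⟩
  set P := probed I x T D with hP
  -- The two extreme completions of the policy's observations: everything unprobed is unfavorable to
  -- side `b`. Both have the announced class, and the weight of `y` lies between theirs.
  let z : Bool → Outcome n := fun b e => if e ∈ P then x e else !I.favorable b e
  have hz : ∀ b, ∑ e, I.gain b e (z b e) = ∑ e ∈ P, I.gain b e (x e) := by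
    intro b
    rw [← Finset.sum_subset (Finset.subset_univ P)]
    · exact Finset.sum_congr rfl fun e he => by simp [z, he]
    · intro e _ he
      simp [z, he, gain]
  have hclass : ∀ b, InClass α (I.score (z b)) (T.output x) := by
    intro b
    rw [← output_eq_of_agree I hcost (y := z b) fun i hi => by simp [z, hP, hi]]
    exact hT _
  have hle : ∀ b, ∑ e, I.gain b e (z b e) ≤ ∑ e, I.gain b e (y e) := by
    intro b
    rw [hz]
    refine (h b).trans ?_
    rw [Finset.sum_congr rfl fun e he => by rw [← hy e he]]
    exact Finset.sum_le_sum_of_subset_of_nonneg (Finset.subset_univ L)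
      fun e _ _ => I.gain_nonneg b e _
  have hs : ∀ x : Outcome n, I.score x =
      ∑ e, min (I.w e) 0 + ∑ e, |I.w e| - ∑ e, I.gain false e (x e) := by
    intro x
    rw [score_eq, ← Finset.sum_congr rfl fun e _ => I.gain_add_gain e (x e),
      Finset.sum_add_distrib]
    ring
  constructor
  · refine (hclass true).1.trans ?_
    rw [score_eq, score_eq]
    linarith [hle true]
  · refine lt_of_le_of_lt ?_ (hclass false).2
    rw [hs, hs]
    linarith [hle false]

/-- Cancel the items common to `L ∪ S` and `P`; further items in `M` only help the list. This
reduces a failure of domination to the event in `Suitable.expect_le`. -/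
theorem sum_sdiff_lt {f : Fin n → ℤ} (hf : ∀ e, 0 ≤ f e) {L S M P : Finset (Fin n)}
    (hM : L ∪ S ⊆ M) (h : ∑ e ∈ M, f e < ∑ e ∈ P, f e) :
    ∑ e ∈ S \ P, f e < ∑ e ∈ (L ∪ S)ᶜ ∩ P, f e := by
  have h1 : ∑ e ∈ L ∪ S, f e ≤ ∑ e ∈ M, f e :=
    Finset.sum_le_sum_of_subset_of_nonneg hM fun e _ _ => hf e
  have h2 := Finset.sum_inter_add_sum_sdiff (L ∪ S) P f
  have h3 := Finset.sum_inter_add_sum_sdiff P (L ∪ S) f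
  have h4 : ∑ e ∈ S \ P, f e ≤ ∑ e ∈ (L ∪ S) \ P, f e :=
    Finset.sum_le_sum_of_subset_of_nonneg
      (Finset.sdiff_subset_sdiff Finset.subset_union_right le_rfl) fun e _ _ => hf e
  have h5 : (L ∪ S)ᶜ ∩ P = P \ (L ∪ S) := by
    ext e; simp only [Finset.mem_inter, Finset.mem_compl, Finset.mem_sdiff]; tauto
  rw [h5]
  rw [Finset.inter_comm] at h3
  linarith

-- If the class is open after both passes, then the policy exceeded `D` or was not dominated on some
-- side. Each side fails with probability at most 1/8 of that of the class being open at the start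
-- of its pass.
open Classical in
theorem expect_undet_le {T : Policy n B} (hT : T.Correct I α) {D : ℝ} (hD : 0 < D)
    {L S R : Finset (Fin n)} (hS : Suitable I D true L S) (hR : Suitable I D false (L ∪ S) R) :
    I.expect (undet I α (L ∪ S ∪ R)) ≤
      I.expect (fun x => if D < T.cost I x then 1 else 0) + 1 / 4 * I.expect (undet I α L) := by
  have h1 := hS.expect_le I hD T (undet_nonneg I α L) fun e => undet_ignores I α
  have h2 := hR.expect_le I hD T (undet_nonneg I α (L ∪ S)) fun e => undet_ignores I α
  have h3 : I.expect (undet I α (L ∪ S)) ≤ I.expect (undet I α L) :=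
    I.expect_mono (undet_anti I α Finset.subset_union_left)
  have key : I.expect (undet I α (L ∪ S ∪ R)) ≤
      I.expect (fun x => (if D < T.cost I x then 1 else 0) + (undet I α L x *
      (if ∑ e ∈ S \ probed I x T D, I.gain true e (x e) <
        ∑ e ∈ (L ∪ S)ᶜ ∩ probed I x T D, I.gain true e (x e) then 1 else 0) +
      undet I α (L ∪ S) x *
      (if ∑ e ∈ R \ probed I x T D, I.gain false e (x e) <
        ∑ e ∈ (L ∪ S ∪ R)ᶜ ∩ probed I x T D, I.gain false e (x e) then 1 else 0))) := by
    refine I.expect_mono fun x => ?_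
    have p1 := undet_nonneg I α L x
    have p2 := undet_nonneg I α (L ∪ S) x
    have p3 : ∀ (φ : Prop) [Decidable φ], (0 : ℝ) ≤ if φ then 1 else 0 := by
      intro φ _; split_ifs <;> simp
    by_cases hx : Undetermined I α (L ∪ S ∪ R) x
    · have u1 : undet I α (L ∪ S ∪ R) x = 1 := if_pos hx
      have u2 : undet I α (L ∪ S) x = 1 := if_pos (hx.mono I Finset.subset_union_left)
      have u3 : undet I α L x = 1 := if_pos (hx.mono I
        (Finset.subset_union_left.trans Finset.subset_union_left))
      rw [u1, u2, u3, one_mul, one_mul]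
      by_cases hc : D < T.cost I x
      · rw [if_pos hc]
        linarith [p3 (∑ e ∈ S \ probed I x T D, I.gain true e (x e) <
          ∑ e ∈ (L ∪ S)ᶜ ∩ probed I x T D, I.gain true e (x e)),
          p3 (∑ e ∈ R \ probed I x T D, I.gain false e (x e) <
          ∑ e ∈ (L ∪ S ∪ R)ᶜ ∩ probed I x T D, I.gain false e (x e))]
      · rw [if_neg hc]
        by_contra hlt
        refine not_undetermined_of_gain I hT (not_lt.1 hc) (fun b => ?_) hx
        by_contra hb
        push Not at hb
        apply hlt
        cases b
        · rw [if_pos (sum_sdiff_lt (L := L ∪ S) (S := R)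
            (fun e => I.gain_nonneg false e (x e)) subset_rfl hb)]
          linarith [p3 (∑ e ∈ S \ probed I x T D, I.gain true e (x e) <
            ∑ e ∈ (L ∪ S)ᶜ ∩ probed I x T D, I.gain true e (x e))]
        · rw [if_pos (sum_sdiff_lt (L := L) (S := S)
            (fun e => I.gain_nonneg true e (x e)) Finset.subset_union_left hb)]
          linarith [p3 (∑ e ∈ R \ probed I x T D, I.gain false e (x e) <
            ∑ e ∈ (L ∪ S ∪ R)ᶜ ∩ probed I x T D, I.gain false e (x e))]
    · have u1 : undet I α (L ∪ S ∪ R) x = 0 := if_neg hx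
      rw [u1]
      exact add_nonneg (p3 _) (add_nonneg (mul_nonneg p1 (p3 _)) (mul_nonneg p2 (p3 _)))
  rw [I.expect_add, I.expect_add] at key
  linarith

/-! ### Cost of a list and the budget-doubling potential -/

variable (α)

/-- The cost on `x` of probing the items of a list, after those in `L`, until the class is
determined. -/
def lcost (x : Outcome n) : Finset (Fin n) → List (Fin n) → ℝ
  | _, [] => 0
  | L, e :: l => undet I α L x * I.c e + lcost x (insert e L) l

theorem lcost_append (x : Outcome n) (L : Finset (Fin n)) (l m : List (Fin n)) :
    lcost I α x L (l ++ m) = lcost I α x L l + lcost I α x (L ∪ l.toFinset) m := by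
  induction l generalizing L with
  | nil => simp [lcost]
  | cons e l ih =>
    have : L ∪ (e :: l).toFinset = insert e L ∪ l.toFinset := by
      ext; simp only [Finset.mem_union, List.mem_toFinset, List.mem_cons, Finset.mem_insert]; tauto
    rw [List.cons_append, lcost, lcost, ih, this, add_assoc]

theorem lcost_le (x : Outcome n) (L : Finset (Fin n)) (l : List (Fin n)) :
    lcost I α x L l ≤ undet I α L x * (l.map I.c).sum := by
  induction l generalizing L with
  | nil => simp [lcost]
  | cons e l ih =>
    rw [lcost, List.map_cons, List.sum_cons, mul_add]
    refine add_le_add le_rfl ((ih _).trans (mul_le_mul_of_nonneg_right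
      (undet_anti I α (Finset.subset_insert e L) x) (List.sum_nonneg ?_)))
    simp only [List.mem_map]
    rintro _ ⟨i, _, rfl⟩
    exact I.c_nonneg i

theorem lcost_eq_sum (x : Outcome n) (L : Finset (Fin n)) (l : List (Fin n)) :
    lcost I α x L l =
      ∑ k : Fin l.length, undet I α (L ∪ (l.take k).toFinset) x * I.c l[k] := by
  induction l generalizing L with
  | nil => simp [lcost]
  | cons e l ih =>
    rw [lcost, ih]
    simp only [List.length_cons]
    rw [Fin.sum_univ_succ]
    congr 1
    · simp
    · refine Finset.sum_congr rfl fun k _ => ?_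
      have : L ∪ ((e :: l).take (k + 1)).toFinset = insert e L ∪ (l.take k).toFinset := by
        ext
        simp only [List.take_succ_cons, Finset.mem_union, List.mem_toFinset, List.mem_cons,
          Finset.mem_insert]
        tauto
      simp only [Fin.val_succ, this, Fin.getElem_fin, List.getElem_cons_succ]

theorem listCost_eq_lcost (l : List (Fin n)) (hl : l.length = n) (σ : Equiv.Perm (Fin n))
    (hσ : ∀ k : Fin n, σ k = l[(k : ℕ)]) (x : Outcome n) :
    listCost I α σ x = lcost I α x ∅ l := by
  rw [lcost_eq_sum]
  unfold listCost
  refine (Fintype.sum_equiv (finCongr hl) _ _ fun k => ?_).symm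
  have hset : ∀ y : Outcome n, (∀ m : Fin n, (m : ℕ) < k → y (σ m) = x (σ m)) ↔
      ∀ i ∈ ∅ ∪ (l.take k).toFinset, y i = x i := by
    intro y
    simp only [Finset.empty_union, List.mem_toFinset, List.mem_take_iff_getElem]
    constructor
    · rintro h _ ⟨m, hm, rfl⟩
      have := h ⟨m, by omega⟩ (by simp; omega)
      rwa [hσ] at this
    · intro h m hm
      rw [hσ]
      exact h _ ⟨m, by omega, rfl⟩
  have hdet : Determined I α σ x (finCongr hl k : Fin n) ↔
      ¬ Undetermined I α (∅ ∪ (l.take k).toFinset) x := by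
    change Determined I α σ x k ↔ _
    unfold Determined Undetermined
    rw [not_not]
    exact exists_congr fun j => forall_congr' fun y => by rw [hset]
  have hc : I.c (σ (finCongr hl k)) = I.c l[k] := by rw [hσ]; rfl
  rw [hc]
  unfold undet
  by_cases hU : Undetermined I α (∅ ∪ (l.take k).toFinset) x
  · rw [if_pos hU, if_neg fun h => hdet.1 h hU, one_mul]
  · rw [if_neg hU, if_pos (hdet.2 hU), zero_mul]

/-- The list `l` is competitive with every adaptive policy up to the budget `D`. -/
def Competitive (D : ℝ) (l : List (Fin n)) : Prop :=
  ∀ (B : ℕ) (α : Fin (B + 1) → ℤ) (T : Policy n B), T.Correct I α →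
    I.expect (fun x => lcost I α x ∅ l) + 648 * D * I.expect (undet I α l.toFinset) ≤
      1296 * I.expect (fun x => min D (2 * T.cost I x))

theorem Suitable.lcost_le {D : ℝ} {b : Bool} {l s : List (Fin n)} (hs : s.Nodup)
    (h : Suitable I D b l.toFinset s.toFinset) (x : Outcome n) :
    lcost I α x l.toFinset s ≤ 162 * D * undet I α l.toFinset x := by
  refine (SSC.lcost_le I α x _ s).trans ?_
  rw [mul_comm, ← List.sum_toFinset I.c hs]
  exact mul_le_mul_of_nonneg_right h.cost_le (undet_nonneg I α _ x)

/-- The coefficients balance: the new cost is 324Du, and 648 · 2D · u/4 = 324Du, together the old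
term 648Du. The remaining 1296D · Pr[cost > D] is paid for by the growth of `min D (2 * cost)` when
`D` doubles. -/
theorem Competitive.phase {D : ℝ} (hD : 0 < D) {l s r : List (Fin n)} (h : Competitive I D l)
    (hsn : s.Nodup) (hs : Suitable I D true l.toFinset s.toFinset)
    (hrn : r.Nodup) (hr : Suitable I D false (l ++ s).toFinset r.toFinset) :
    Competitive I (D + D) (l ++ s ++ r) := by
  intro B α T hT
  have h0 := h B α T hT
  have hu := expect_undet_le I hT hD hs (by rwa [List.toFinset_append] at hr)
  have hl : I.expect (fun x => lcost I α x ∅ (l ++ s ++ r)) ≤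
      I.expect (fun x => lcost I α x ∅ l) + 324 * D * I.expect (undet I α l.toFinset) := by
    rw [← I.expect_const_mul, ← I.expect_add]
    refine I.expect_mono fun x => ?_
    rw [lcost_append, lcost_append]
    simp only [Finset.empty_union]
    have h1 := hs.lcost_le I α hsn x
    have h2 := hr.lcost_le I α hrn x
    have h3 := undet_anti I α (L := l.toFinset) (M := (l ++ s).toFinset)
      (by rw [List.toFinset_append]; exact Finset.subset_union_left) x
    have h4 := mul_le_mul_of_nonneg_left h3 (by positivity : 0 ≤ 162 * D)
    linarith
  have hm : I.expect (fun x => min D (2 * T.cost I x)) +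
      D * I.expect (fun x => if D < T.cost I x then 1 else 0) ≤
      I.expect (fun x => min (D + D) (2 * T.cost I x)) := by
    rw [← I.expect_const_mul, ← I.expect_add]
    refine I.expect_mono fun x => ?_
    split_ifs with hx
    · rw [min_eq_left (by linarith), min_eq_left (by linarith)]; linarith
    · rw [mul_zero, add_zero]; exact min_le_min (by linarith) le_rfl
  rw [← List.toFinset_append, ← List.toFinset_append] at hu
  have hu' := mul_le_mul_of_nonneg_left hu (by positivity : 0 ≤ 1296 * D)
  linarith

/-- A policy that pays less than the least positive cost has probed only free items, all of which
are in `l`; so an open class forces it to pay at least `D`. -/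
theorem Competitive.init {D : ℝ} (hD : 0 < D) (hmin : ∀ e, I.c e ≤ 0 ∨ D ≤ I.c e)
    {l : List (Fin n)} (hl : ∀ e, e ∈ l ↔ I.c e ≤ 0) : Competitive I D l := by
  intro B α T hT
  have h1 : I.expect (fun x => lcost I α x ∅ l) ≤ 0 := by
    have : I.expect (fun _ : Outcome n => (0 : ℝ)) = 0 := by simp [expect]
    rw [← this]
    refine I.expect_mono fun x => (lcost_le I α x ∅ l).trans ?_
    have : (l.map I.c).sum = 0 := by
      apply List.sum_eq_zero
      simp only [List.mem_map]
      rintro _ ⟨i, hi, rfl⟩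
      exact le_antisymm ((hl i).1 hi) (I.c_nonneg i)
    rw [this, mul_zero]
  have h2 : D * I.expect (undet I α l.toFinset) ≤
      I.expect (fun x => min D (2 * T.cost I x)) := by
    rw [← I.expect_const_mul]
    refine I.expect_mono fun x => ?_
    by_cases hx : D ≤ T.cost I x
    · rw [min_eq_left (by linarith)]
      unfold undet
      split_ifs <;> linarith
    · have : undet I α l.toFinset x = 0 := by
        refine if_neg (not_undetermined_of_gain I hT le_rfl fun b => ?_)
        refine Finset.sum_le_sum_of_subset_of_nonneg (fun e he => ?_)
          fun e _ _ => I.gain_nonneg b e _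
        have := cost_le_of_mem_probed I (cost_nonneg I x T) he
        rw [List.mem_toFinset, hl]
        exact (hmin e).resolve_right fun h => hx (h.trans this)
      rw [this, mul_zero]
      exact le_min hD.le (by linarith [cost_nonneg I x T])
  have h3 : 0 ≤ D * I.expect (undet I α l.toFinset) :=
    mul_nonneg hD.le (I.expect_nonneg (undet_nonneg I α _))
  linarith

theorem Competitive.finish {D : ℝ} (hD : 0 ≤ D) {l r : List (Fin n)} (h : Competitive I D l)
    (hr : (r.map I.c).sum ≤ D) {T : Policy n B} (hT : T.Correct I α) :
    I.expect (fun x => lcost I α x ∅ (l ++ r)) ≤ 2592 * T.expectedCost I := by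
  have h0 := h B α T hT
  have h1 : I.expect (fun x => lcost I α x ∅ (l ++ r)) ≤
      I.expect (fun x => lcost I α x ∅ l) + D * I.expect (undet I α l.toFinset) := by
    rw [← I.expect_const_mul, ← I.expect_add]
    refine I.expect_mono fun x => ?_
    rw [lcost_append, Finset.empty_union]
    have := lcost_le I α x l.toFinset r
    have := mul_le_mul_of_nonneg_left hr (undet_nonneg I α l.toFinset x)
    linarith
  have h2 : I.expect (fun x => min D (2 * T.cost I x)) ≤ 2 * T.expectedCost I := by
    unfold expectedCost
    rw [← I.expect_const_mul]
    exact I.expect_mono fun x => min_le_right _ _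
  have h3 : 0 ≤ D * I.expect (undet I α l.toFinset) :=
    mul_nonneg hD (I.expect_nonneg (undet_nonneg I α _))
  linarith

end SSC

end

noncomputable section

namespace SSC

/-! ### Reasoning about programs of the RAM -/

variable {n : ℕ}

/-- The abstract content of the memory: the list of items, a loop counter and real registers. -/
structure Mem (n : ℕ) where
  lst : List (Fin n)
  e : ℕ
  W : ℝ
  tot : ℝ
  D : ℝ
  θ : ℝ
  acc : ℝ

/-- Change the register that is stored in the real array `a`. -/
def Mem.set (A : Mem n) (a : ℕ) (v : ℝ) : Mem n :=
  { A with
    W := if a = 3 then v else A.W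
    tot := if a = 4 then v else A.tot
    D := if a = 5 then v else A.D
    θ := if a = 6 then v else A.θ
    acc := if a = 7 then v else A.acc }

variable (I : Items n)

/-- The memory `s` of the RAM represents `A`. -/
structure Rep (s : RAM.Store) (A : Mem n) : Prop where
  size : s.nat 0 0 = n
  out : ∀ k (h : k < A.lst.length), s.nat 1 k = A.lst[k]
  len : s.nat 2 0 = A.lst.length
  flag : ∀ i : Fin n, s.nat 3 i = if i ∈ A.lst then 1 else 0
  idx : s.nat 4 0 = A.e
  p : ∀ i : Fin n, s.real 0 i = I.p i
  c : ∀ i : Fin n, s.real 1 i = I.c i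
  w : ∀ i : Fin n, s.real 2 i = I.w i
  W : s.real 3 0 = A.W
  tot : s.real 4 0 = A.tot
  D : s.real 5 0 = A.D
  θ : s.real 6 0 = A.θ
  acc : s.real 7 0 = A.acc

theorem rep_input : Rep I I.input ⟨[], 0, 0, 0, 0, 0, 0⟩ := by
  constructor <;> simp [Items.input]

/-- Started in a memory representing `A`, the program `P` halts within `T` steps in a memory
representing some `A'` with `Q A'`. -/
def Hoare (P : RAM.Program) (A : Mem n) (Q : Mem n → Prop) (T : ℕ) : Prop :=
  ∀ s, Rep I s A → ∃ s' A' t, RAM.Run P s s' t ∧ Rep I s' A' ∧ Q A' ∧ t ≤ T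

/-- On memories representing `A`, the test `b` decides `φ`. -/
def Decides (b : RAM.Test) (A : Mem n) (φ : Prop) : Prop := ∀ s, Rep I s A → (b.Holds s ↔ φ)

namespace Hoare

open RAM

variable {I} {A : Mem n} {Q R : Mem n → Prop} {P P' : Program} {b : Test} {φ : Prop} {T U : ℕ}

theorem weaken (h : Hoare I P A Q T) (hQ : ∀ A', Q A' → R A') (hT : T ≤ U) : Hoare I P A R U := by
  intro s hs
  obtain ⟨s', A', t, h1, h2, h3, h4⟩ := h s hs
  exact ⟨s', A', t, h1, h2, hQ A' h3, h4.trans hT⟩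

theorem nop (h : Q A) : Hoare I .nop A Q 1 :=
  fun s hs => ⟨s, A, 1, .nop s, hs, h, le_rfl⟩

theorem seq (h : Hoare I P A Q T) (h' : ∀ A', Q A' → Hoare I P' A' R U) :
    Hoare I (.seq P P') A R (T + U) := by
  intro s hs
  obtain ⟨s₁, A₁, t, h1, h2, h3, h4⟩ := h s hs
  obtain ⟨s₂, A₂, u, k1, k2, k3, k4⟩ := h' A₁ h3 s₁ h2
  exact ⟨s₂, A₂, t + u, .seq h1 k1, k2, k3, add_le_add h4 k4⟩

theorem cond (hb : Decides I b A φ) (h : φ → Hoare I P A Q T) (h' : ¬ φ → Hoare I P' A Q T) :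
    Hoare I (.cond b P P') A Q (T + 1) := by
  intro s hs
  by_cases hφ : φ
  · obtain ⟨s', A', t, h1, h2, h3, h4⟩ := h hφ s hs
    exact ⟨s', A', t + 1, .condTrue ((hb s hs).2 hφ) h1, h2, h3, by omega⟩
  · obtain ⟨s', A', t, h1, h2, h3, h4⟩ := h' hφ s hs
    exact ⟨s', A', t + 1, .condFalse (fun hh => hφ ((hb s hs).1 hh)) h1, h2, h3, by omega⟩

/-- The index `k` of the invariant bounds the iterations still to come, so termination and the step
bound come out of the same induction. -/
theorem loop {J : ℕ → Mem n → Prop} {φ : Mem n → Prop} (hb : ∀ A, Decides I b A (φ A))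
    (hstep : ∀ k A, J k A → φ A → ∃ k', k = k' + 1 ∧ Hoare I P A (J k') T) (k : ℕ) :
    ∀ A, J k A → Hoare I (.loop b P) A (fun A' => (∃ k', J k' A') ∧ ¬ φ A') (k * (T + 1) + 1) := by
  induction k with
  | zero =>
    intro A hA s hs
    by_cases hφ : φ A
    · obtain ⟨k', hk, -⟩ := hstep 0 A hA hφ
      omega
    · exact ⟨s, A, 1, .loopFalse fun hh => hφ ((hb A s hs).1 hh), hs, ⟨⟨0, hA⟩, hφ⟩, by omega⟩
  | succ k ih =>
    intro A hA s hs
    by_cases hφ : φ A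
    · obtain ⟨k', hk, hP⟩ := hstep (k + 1) A hA hφ
      obtain rfl : k = k' := by omega
      obtain ⟨s₁, A₁, t, h1, h2, h3, h4⟩ := hP s hs
      obtain ⟨s₂, A₂, u, k1, k2, k3, k4⟩ := ih A₁ h3 s₁ h2
      refine ⟨s₂, A₂, t + u + 1, .loopTrue ((hb A s hs).2 hφ) h1 k1, k2, k3, ?_⟩
      rw [Nat.succ_mul]
      omega
    · exact ⟨s, A, 1, .loopFalse fun hh => hφ ((hb A s hs).1 hh), hs, ⟨⟨k + 1, hA⟩, hφ⟩,
        by omega⟩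

end Hoare

/-! ### Program fragments and their specifications -/

namespace RAM

/-- The loop counter. -/
def counter : NExpr := .read 4 (.const 0)

/-- The number of items. -/
def size : NExpr := .read 0 (.const 0)

/-- A real register. -/
def reg (a : ℕ) : RExpr := .read a (.const 0)

/-- The entry of the real array `a` for the current item. -/
def entry (a : ℕ) : RExpr := .read a counter

/-- Assign to a real register. -/
def setReg (a : ℕ) (r : RExpr) : Program := .setReal a (.const 0) r

def resetCounter : Program := .setNat 4 (.const 0) (.const 0)

def incrCounter : Program := .setNat 4 (.const 0) (.add counter (.const 1))

/-- Append the current item to the list. -/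
def appendItem : Program :=
  .seq (.setNat 1 (.read 2 (.const 0)) counter)
    (.seq (.setNat 2 (.const 0) (.add (.read 2 (.const 0)) (.const 1)))
      (.setNat 3 counter (.const 1)))

/-- Run a program for every item. -/
def forItems (P : Program) : Program :=
  .seq resetCounter (.loop (.neg (.natLe size counter)) (.seq P incrCounter))

/-- The current item is not in the list. -/
def unlisted : Test := .natLe (.read 3 counter) (.const 0)

end RAM

open RAM

variable {I} {A : Mem n} {s : Store}

theorem Rep.counter_eval (h : Rep I s A) : counter.eval s = A.e := h.idx

theorem Rep.entry_p (h : Rep I s A) {i : Fin n} (hi : A.e = i) : (entry 0).eval s = I.p i := by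
  simp only [entry, RExpr.eval, h.counter_eval, hi, h.p]

theorem Rep.entry_c (h : Rep I s A) {i : Fin n} (hi : A.e = i) : (entry 1).eval s = I.c i := by
  simp only [entry, RExpr.eval, h.counter_eval, hi, h.c]

theorem Rep.entry_w (h : Rep I s A) {i : Fin n} (hi : A.e = i) : (entry 2).eval s = I.w i := by
  simp only [entry, RExpr.eval, h.counter_eval, hi, h.w]

theorem Rep.reg_W (h : Rep I s A) : (reg 3).eval s = A.W := h.W
theorem Rep.reg_tot (h : Rep I s A) : (reg 4).eval s = A.tot := h.tot
theorem Rep.reg_D (h : Rep I s A) : (reg 5).eval s = A.D := h.D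
theorem Rep.reg_θ (h : Rep I s A) : (reg 6).eval s = A.θ := h.θ
theorem Rep.reg_acc (h : Rep I s A) : (reg 7).eval s = A.acc := h.acc

theorem Rep.unlisted_iff (h : Rep I s A) {i : Fin n} (hi : A.e = i) :
    unlisted.Holds s ↔ i ∉ A.lst := by
  simp only [unlisted, Test.Holds, NExpr.eval, h.counter_eval, hi, h.flag]
  split_ifs with hm <;> simp [hm]

theorem hoare_setReg {a : ℕ} (ha : 3 ≤ a) {r : RExpr} {v : ℝ}
    (hr : ∀ s, Rep I s A → r.eval s = v) : Hoare I (setReg a r) A (· = A.set a v) 1 := by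
  intro s hs
  refine ⟨_, _, _, Run.setReal a (.const 0) r s, ?_, rfl, le_rfl⟩
  rw [hr s hs]
  obtain ⟨h1, h2, h3, h4, h5, h6, h7, h8, h9, h10, h11, h12, h13⟩ := hs
  have ne : ∀ k, k < 3 → k ≠ a := fun k hk => by omega
  have aux : ∀ k, Function.update s.real a (Function.update (s.real a) 0 v) k 0 =
      if a = k then v else s.real k 0 := by
    intro k
    by_cases hk : a = k
    · subst hk; simp
    · simp [hk, Function.update_of_ne (Ne.symm hk)]
  constructor <;>
    simp only [Store.writeReal, Mem.set, NExpr.eval, aux, h9, h10, h11, h12, h13,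
      Function.update_of_ne (ne 0 (by norm_num)), Function.update_of_ne (ne 1 (by norm_num)),
      Function.update_of_ne (ne 2 (by norm_num))]
  all_goals assumption

theorem hoare_setCounter {x : NExpr} {v : ℕ} (hx : ∀ s, Rep I s A → x.eval s = v) :
    Hoare I (.setNat 4 (.const 0) x) A (· = { A with e := v }) 1 := by
  intro s hs
  refine ⟨_, _, _, Run.setNat 4 (.const 0) x s, ?_, rfl, le_rfl⟩
  rw [hx s hs]
  obtain ⟨h1, h2, h3, h4, h5, h6, h7, h8, h9, h10, h11, h12, h13⟩ := hs
  constructor <;> simp [Store.writeNat, NExpr.eval, Function.update] <;> assumption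

theorem hoare_resetCounter : Hoare I resetCounter A (· = { A with e := 0 }) 1 :=
  hoare_setCounter fun _ _ => rfl

theorem hoare_incrCounter : Hoare I incrCounter A (· = { A with e := A.e + 1 }) 1 :=
  hoare_setCounter fun _ h => by simp only [NExpr.eval, h.counter_eval]

theorem hoare_appendItem {i : Fin n} (hi : A.e = i) :
    Hoare I appendItem A (· = { A with lst := A.lst ++ [i] }) 3 := by
  intro s hs
  refine ⟨_, _, _, Run.seq (Run.setNat _ _ _ _) (Run.seq (Run.setNat _ _ _ _)
    (Run.setNat _ _ _ _)), ?_, rfl, le_rfl⟩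
  obtain ⟨h1, h2, h3, h4, h5, h6, h7, h8, h9, h10, h11, h12, h13⟩ := hs
  constructor
  case out =>
    intro k hk
    simp only [Store.writeNat, NExpr.eval, counter, Function.update, h3, h5, hi]
    rw [List.getElem_append]
    simp only [List.length_append, List.length_singleton] at hk
    by_cases hkl : k < A.lst.length
    · simp [hkl, hkl.ne, h2 k hkl]
    · obtain rfl : k = A.lst.length := by omega
      simp
  case flag =>
    intro k
    simp only [Store.writeNat, NExpr.eval, counter, Function.update, h3, h5, hi]
    by_cases hk : k = i
    · subst hk; simp [Function.update, h5, hi]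
    · have : (k : ℕ) ≠ i := fun h => hk (Fin.ext h)
      simp [Function.update, h5, hi, this, hk, h4 k]
  all_goals simp [Store.writeNat, NExpr.eval, counter, Function.update, h1, h3, h5, hi, h6, h7, h8,
    h9, h10, h11, h12, h13]

/-- A loop over all items maintains an invariant depending on the number of items treated. -/
theorem hoare_forItems {P : Program} {J : ℕ → Mem n → Prop} {T : ℕ}
    (h0 : J 0 { A with e := 0 }) (he : ∀ k A, J k A → A.e = k)
    (hstep : ∀ (i : Fin n) A, J i A → A.e = i →
      Hoare I P A (fun A' => A'.e = i ∧ J (i + 1) { A' with e := i + 1 }) T) :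
    Hoare I (forItems P) A (J n) (n * (T + 2) + 2) := by
  have hl := Hoare.loop (I := I) (b := .neg (.natLe size counter)) (P := .seq P incrCounter)
    (J := fun k A => ∃ j, j + k = n ∧ J j A) (φ := fun A => A.e < n) (T := T + 1)
    (fun A s hs => by
      simp only [Test.Holds, hs.counter_eval, size, NExpr.eval, hs.size, not_le]) ?_
    n { A with e := 0 } ⟨0, by omega, h0⟩
  · refine (hoare_resetCounter.seq (R := J n) (U := n * (T + 2) + 1) ?_).weaken
      (fun _ h => h) (by omega)
    rintro _ rfl
    refine hl.weaken ?_ le_rfl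
    rintro A' ⟨⟨k, j, hj, hJ⟩, hn⟩
    rw [he j A' hJ] at hn
    obtain rfl : j = n := by omega
    exact hJ
  · rintro k A ⟨j, hj, hJ⟩ hlt
    have hjA := he j A hJ
    refine ⟨k - 1, by omega, ?_⟩
    have hjn : j < n := by omega
    refine (hstep ⟨j, hjn⟩ A hJ hjA).seq ?_
    rintro A' ⟨hA', hJ'⟩
    refine hoare_incrCounter.weaken ?_ le_rfl
    rintro _ rfl
    rw [hA']
    exact ⟨j + 1, by omega, hJ'⟩

end SSC

end

noncomputable section

namespace SSC

/-! ### The search for valuable items -/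

open RAM

variable {n : ℕ} (I : Items n)

/-- Invariant of the search for new items for side `b`: the items of `s` have been appended to the
list `l`, and the first `k` items have been considered at scale `θ`. -/
structure PassInv (D : ℝ) (b : Bool) (l s : List (Fin n)) (acc θ : ℝ) (k : ℕ) : Prop where
  nodup : (l ++ s).Nodup
  acc_eq : acc = (s.map I.c).sum
  acc_le : acc ≤ 162 * D
  state : (acc ≤ 161 * D ∧ (∀ i ∈ s, 1 / 16 * I.c i ≤ D * I.rate b θ i) ∧
      (I.absWeight < θ + θ ∨
        ∀ i, i ∉ l → i ∉ s → I.c i ≤ D → D * I.rate b (θ + θ) i ≤ 1 / 16 * I.c i) ∧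
      ∀ i : Fin n, (i : ℕ) < k → i ∉ l → i ∉ s → I.c i ≤ D → D * I.rate b θ i ≤ 1 / 16 * I.c i) ∨
    (161 * D < acc ∧ ∃ η : ℝ, 0 < η ∧
      (I.absWeight < η ∨ ∀ i, i ∉ l → i ∉ s → I.c i ≤ D → D * I.rate b η i ≤ 1 / 16 * I.c i) ∧
      ∀ i ∈ s, 1 / 16 * I.c i ≤ D * I.rate b (η / 2) i)

variable {I} {D : ℝ} {b : Bool} {l s : List (Fin n)} {acc θ : ℝ} {k : ℕ}

/-- No gain can exceed the total weight, so at scale `θ + θ` there is nothing to check. -/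
theorem PassInv.init (hD : 0 ≤ D) (hl : l.Nodup) (hθ : 0 < θ) (hW : I.absWeight ≤ θ) :
    PassInv I D b l [] 0 θ 0 where
  nodup := by simpa using hl
  acc_eq := by simp
  acc_le := by positivity
  state := Or.inl ⟨by positivity, by simp, Or.inl (by linarith), by simp⟩

/-- Rates grow as the scale shrinks, so collected items stay valuable; the completed scan at `θ`
becomes the statement about the doubled scale. -/
theorem PassInv.halve (hD : 0 ≤ D) (hθ : 0 < θ) (h : PassInv I D b l s acc θ n) :
    PassInv I D b l s acc (θ / 2) 0 where
  nodup := h.nodup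
  acc_eq := h.acc_eq
  acc_le := h.acc_le
  state := by
    rcases h.state with ⟨h1, h2, h3, h4⟩ | h
    · refine Or.inl ⟨h1, fun i hi => (h2 i hi).trans (mul_le_mul_of_nonneg_left
        (I.rate_anti b (half_pos hθ) (by linarith) i) hD), Or.inr ?_, by simp⟩
      rw [add_halves]
      exact fun i => h4 i i.2
    · exact Or.inr h

theorem PassInv.skip {i : Fin n} (h : PassInv I D b l s acc θ i)
    (hi : ¬ (i ∉ l ++ s ∧ acc ≤ 161 * D ∧ I.c i ≤ D ∧ 1 / 16 * I.c i ≤ D * I.rate b θ i)) :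
    PassInv I D b l s acc θ (i + 1) where
  nodup := h.nodup
  acc_eq := h.acc_eq
  acc_le := h.acc_le
  state := by
    rcases h.state with ⟨h1, h2, h3, h4⟩ | h
    · refine Or.inl ⟨h1, h2, h3, fun j hj hjl hjs hc => ?_⟩
      rcases Nat.lt_succ_iff_lt_or_eq.1 hj with hlt | heq
      · exact h4 j hlt hjl hjs hc
      · obtain rfl : j = i := Fin.ext heq
        by_contra hlt
        exact hi ⟨by simp [hjl, hjs], h1, hc, (not_le.1 hlt).le⟩
    · exact Or.inr h

theorem PassInv.append (hθ : 0 < θ) {i : Fin n} (h : PassInv I D b l s acc θ i)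
    (hi : i ∉ l ++ s ∧ acc ≤ 161 * D ∧ I.c i ≤ D ∧ 1 / 16 * I.c i ≤ D * I.rate b θ i) :
    PassInv I D b l (s ++ [i]) (acc + I.c i) θ (i + 1) where
  nodup := by
    rw [← List.append_assoc]
    exact h.nodup.append (List.nodup_singleton i) (by simpa using hi.1)
  acc_eq := by simp [h.acc_eq]
  acc_le := by linarith [hi.2.1, hi.2.2.1]
  state := by
    obtain ⟨hil, hacc, hc, hv⟩ := hi
    rcases h.state with ⟨h1, h2, h3, h4⟩ | h
    · have h2' : ∀ j ∈ s ++ [i], 1 / 16 * I.c j ≤ D * I.rate b θ j := by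
        intro j hj
        rcases List.mem_append.1 hj with hj | hj
        · exact h2 j hj
        · rw [List.mem_singleton.1 hj]; exact hv
      have h3' : I.absWeight < θ + θ ∨ ∀ j, j ∉ l → j ∉ s ++ [i] → I.c j ≤ D →
          D * I.rate b (θ + θ) j ≤ 1 / 16 * I.c j :=
        h3.imp_right fun h j hl hs => h j hl fun hj => hs (List.mem_append_left _ hj)
      by_cases hle : acc + I.c i ≤ 161 * D
      · refine Or.inl ⟨hle, h2', h3', fun j hj hjl hjs => ?_⟩
        simp only [List.mem_append, List.mem_singleton, not_or] at hjs
        refine h4 j ?_ hjl hjs.1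
        exact lt_of_le_of_ne (Nat.lt_succ_iff.1 hj) fun h => hjs.2 (Fin.ext h)
      -- The cost limit is crossed here: the doubled scale left nothing valuable outside, and every
      -- collected item is valuable at half of it.
      · refine Or.inr ⟨not_le.1 hle, θ + θ, by linarith, h3', ?_⟩
        rwa [add_self_div_two]
    · linarith [h.1]

/-- Scale 1/2 is reached right after the scan at scale 1, so an unfinished collection is suitable
with `θ = 1`. -/
theorem PassInv.suitable (h : PassInv I D b l s acc (1 / 2) k) :
    Suitable I D b l.toFinset s.toFinset := by
  have hs : s.Nodup := h.nodup.of_append_right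
  have hsum : ∑ e ∈ s.toFinset, I.c e = acc := by rw [h.acc_eq, List.sum_toFinset I.c hs]
  refine ⟨?_, by rw [hsum]; exact h.acc_le, ?_⟩
  · rw [Finset.disjoint_left]
    intro i hi hi'
    rw [List.mem_toFinset] at hi hi'
    exact (List.disjoint_of_nodup_append h.nodup) hi hi'
  · simp only [List.mem_toFinset, hsum]
    rcases h.state with ⟨h1, h2, h3, h4⟩ | ⟨h1, η, h2, h3, h4⟩
    · rw [add_halves] at h3
      exact ⟨1, one_pos, h3, Or.inl rfl⟩
    · exact ⟨η, h2, h3, Or.inr ⟨h1, h4⟩⟩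

namespace RAM

/-- The current item, with favorable outcome of probability `q` and absolute weight `v`, is
valuable at the current budget and scale. -/
def valuableTest (q v : RExpr) : Test :=
  .conj (.realLe (.mul (.mul (.const (1 / 16)) (entry 1)) (reg 6)) (.mul (.mul (reg 5) q) v))
    (.realLe (.mul (.const (1 / 16)) (entry 1)) (.mul (reg 5) q))

def outcomeProb (b : Bool) : RExpr := if b then entry 0 else .sub (.const 1) (entry 0)

def weightNonneg : Test := .realLe (.const 0) (entry 2)

/-- A disjunction over the sign of the weight, written with negation and conjunction. A negative
weight swaps the favorable outcome and replaces the weight by its negative. -/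
def sideTest (b : Bool) : Test :=
  .neg (.conj (.neg (.conj weightNonneg (valuableTest (outcomeProb b) (entry 2))))
    (.neg (.conj (.neg weightNonneg)
      (valuableTest (outcomeProb !b) (.sub (.const 0) (entry 2))))))

def selectTest (b : Bool) : Test :=
  .conj unlisted (.conj (.realLe (reg 7) (.mul (.const 161) (reg 5)))
    (.conj (.realLe (entry 1) (reg 5)) (sideTest b)))

/-- Append the unlisted valuable items of one scale. -/
def scan (b : Bool) : Program :=
  forItems (.cond (selectTest b) (.seq appendItem (setReg 7 (.add (reg 7) (entry 1)))) .nop)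

/-- Append items for side `b`, going through all scales. -/
def pass (b : Bool) : Program :=
  .seq (setReg 7 (.const 0)) (.seq (setReg 6 (.const 1))
    (.seq (.loop (.neg (.realLe (reg 3) (reg 6))) (setReg 6 (.add (reg 6) (reg 6))))
      (.loop (.realLe (.const 1) (reg 6))
        (.seq (scan b) (setReg 6 (.div (reg 6) (.const 2)))))))

end RAM

/-! ### Correctness and running time of one pass -/

variable {A : Mem n} {t : Store}

/-- The minimum in the truncation splits into the two comparisons of `valuableTest`, with the
division by `θ` cleared. -/
theorem le_mul_rate_iff (hD : 0 ≤ D) (hθ : 0 < θ) (i : Fin n) :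
    1 / 16 * I.c i ≤ D * I.rate b θ i ↔
      1 / 16 * I.c i * θ ≤ D * I.favProb b i * |(I.w i : ℝ)| ∧
        1 / 16 * I.c i ≤ D * I.favProb b i := by
  have h0 : 0 ≤ D * I.favProb b i := mul_nonneg hD (I.favProb_nonneg b i)
  rw [Items.rate, Items.trunc, ← mul_assoc, mul_min_of_nonneg _ _ h0, le_min_iff, mul_one,
    ← mul_div_assoc, le_div_iff₀ hθ]

theorem Rep.weightNonneg_iff {t : Store} (h : Rep I t A) {i : Fin n} (hi : A.e = i) :
    weightNonneg.Holds t ↔ 0 ≤ I.w i := by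
  simp only [weightNonneg, Test.Holds, RExpr.eval, h.entry_w hi, Rat.cast_zero]
  exact_mod_cast Iff.rfl

theorem Rep.selectTest_iff (h : Rep I t A) {i : Fin n} (hi : A.e = i) (hD : 0 ≤ A.D)
    (hθ : 0 < A.θ) :
    (selectTest b).Holds t ↔ i ∉ A.lst ∧ A.acc ≤ 161 * A.D ∧ I.c i ≤ A.D ∧
      1 / 16 * I.c i ≤ A.D * I.rate b A.θ i := by
  have hq : ∀ b, (outcomeProb b).eval t = if b then I.p i else 1 - I.p i := by
    intro b
    cases b <;> simp [outcomeProb, RExpr.eval, h.entry_p hi]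
  have hside : (sideTest b).Holds t ↔ 1 / 16 * I.c i ≤ A.D * I.rate b A.θ i := by
    rw [le_mul_rate_iff hD hθ]
    simp only [sideTest, Test.Holds, valuableTest, RExpr.eval, h.weightNonneg_iff hi, hq,
      h.entry_c hi, h.entry_w hi, h.reg_D, h.reg_θ, Items.favProb, Items.favorable, not_and_or, not_not]
    by_cases hw0 : 0 ≤ I.w i
    · have : (0 : ℝ) ≤ I.w i := by exact_mod_cast hw0
      simp [hw0, abs_of_nonneg this]
    · have : (I.w i : ℝ) < 0 := by exact_mod_cast not_le.1 hw0
      simp [hw0, abs_of_neg this]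
  simp only [selectTest, Test.Holds, h.unlisted_iff hi, hside, RExpr.eval, h.reg_acc, h.reg_D,
    h.entry_c hi]
  norm_num

theorem hoare_scan (hD : 0 ≤ A.D) (hθ : 0 < A.θ) (hl : A.lst = l ++ s)
    (h : PassInv I A.D b l s A.acc A.θ 0) :
    Hoare I (scan b) A (fun A' => ∃ s acc, A' = { A with lst := l ++ s, e := n, acc := acc } ∧
      PassInv I A.D b l s acc A.θ n) (n * 7 + 2) := by
  refine (hoare_forItems (T := 5)
    (J := fun k A' => ∃ s acc, A' = { A with lst := l ++ s, e := k, acc := acc } ∧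
      PassInv I A.D b l s acc A.θ k) ⟨s, A.acc, by rw [← hl], h⟩ ?_ ?_)
  · rintro k _ ⟨s, acc, rfl, -⟩
    rfl
  · rintro i _ ⟨s, acc, rfl, h⟩ -
    refine Hoare.cond (T := 4) (fun t ht => ht.selectTest_iff (i := i) rfl hD hθ) ?_ ?_
    · intro hi
      refine (hoare_appendItem (i := i) rfl).seq (U := 1) ?_
      rintro _ rfl
      refine (hoare_setReg (v := acc + I.c i) (by norm_num) fun t ht => ?_).weaken ?_ le_rfl
      · simp only [RExpr.eval, ht.reg_acc, ht.entry_c (i := i) rfl]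
      · rintro _ rfl
        exact ⟨rfl, s ++ [i], acc + I.c i, by simp [Mem.set], h.append hθ hi⟩
    · intro hi
      exact (Hoare.nop ⟨rfl, s, acc, rfl, h.skip hi⟩).weaken (fun _ h => h) (by norm_num)

theorem hoare_pass (b : Bool) (hD : 0 < A.D) (hW : A.W = I.absWeight) (hl : A.lst.Nodup) {N : ℕ}
    (hN : I.absWeight ≤ 2 ^ N) :
    Hoare I (pass b) A (fun A' => ∃ s e θ acc,
      A' = { A with lst := A.lst ++ s, e := e, θ := θ, acc := acc } ∧ (A.lst ++ s).Nodup ∧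
        Suitable I A.D b A.lst.toFinset s.toFinset) ((N + 1) * (n * 7 + 8)) := by
  have double : ∀ A₁ : Mem n, A₁ = { A with θ := 1, acc := 0 } →
      Hoare I (.loop (.neg (.realLe (reg 3) (reg 6))) (setReg 6 (.add (reg 6) (reg 6)))) A₁
        (fun A' => ∃ m ≤ N, A' = { A with θ := 2 ^ m, acc := 0 } ∧ I.absWeight ≤ 2 ^ m)
        (N * 2 + 1) := by
    rintro _ rfl
    refine (Hoare.loop (φ := fun A => A.θ < A.W)
      (J := fun k A' => k ≤ N ∧ A' = { A with θ := 2 ^ (N - k), acc := 0 }) ?_ ?_ N _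
      ⟨le_rfl, by simp⟩).weaken ?_ le_rfl
    · intro A t ht
      simp only [Test.Holds, ht.reg_W, ht.reg_θ, not_le]
    · rintro k _ ⟨hk, rfl⟩ hlt
      have hk0 : k ≠ 0 := by
        rintro rfl
        simp only [Nat.sub_zero, hW] at hlt
        linarith
      refine ⟨k - 1, by omega, ?_⟩
      refine (hoare_setReg (v := 2 ^ (N - k) + 2 ^ (N - k)) (by norm_num) fun t ht => ?_).weaken ?_
        le_rfl
      · simp only [RExpr.eval, ht.reg_θ]
      · rintro _ rfl
        refine ⟨by omega, ?_⟩
        have : N - (k - 1) = N - k + 1 := by omega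
        simp [Mem.set, this, pow_succ, mul_two]
    · rintro _ ⟨⟨k, hk, rfl⟩, hle⟩
      refine ⟨N - k, by omega, rfl, ?_⟩
      rw [← hW]
      exact not_lt.1 hle
  have halve : ∀ m ≤ N, I.absWeight ≤ 2 ^ m →
      Hoare I (.loop (.realLe (.const 1) (reg 6)) (.seq (scan b)
        (setReg 6 (.div (reg 6) (.const 2))))) { A with θ := 2 ^ m, acc := 0 }
      (fun A' => ∃ s e θ acc,
        A' = { A with lst := A.lst ++ s, e := e, θ := θ, acc := acc } ∧ (A.lst ++ s).Nodup ∧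
          Suitable I A.D b A.lst.toFinset s.toFinset) ((N + 1) * (n * 7 + 4) + 1) := by
    intro m hm hWm
    refine (Hoare.loop (φ := fun A => 1 ≤ A.θ) (T := n * 7 + 3)
      -- With `k` scans to come the scale is `2 ^ k / 2`, so the loop is left exactly at 1/2, after
      -- the scan at scale 1.
      (J := fun k A' => ∃ s e acc,
        A' = { A with lst := A.lst ++ s, e := e, θ := 2 ^ k / 2, acc := acc } ∧
          PassInv I A.D b A.lst s acc (2 ^ k / 2) 0) ?_ ?_ (m + 1) _ ?_).weaken ?_ ?_
    · intro A t ht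
      simp only [Test.Holds, RExpr.eval, ht.reg_θ, Rat.cast_one]
    · rintro k _ ⟨s, e, acc, rfl, h⟩ hle
      have hk0 : k ≠ 0 := by
        rintro rfl
        norm_num at hle
      obtain ⟨k, rfl⟩ := Nat.exists_eq_succ_of_ne_zero hk0
      refine ⟨k, rfl, ?_⟩
      have hθ : (0 : ℝ) < 2 ^ (k + 1) / 2 := by positivity
      refine (hoare_scan (A := { A with lst := A.lst ++ s, e := e, θ := 2 ^ (k + 1) / 2, acc := acc })
        hD.le hθ rfl h).seq (U := 1) ?_
      rintro _ ⟨s, acc, rfl, h⟩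
      refine (hoare_setReg (v := 2 ^ (k + 1) / 2 / 2) (by norm_num) fun t ht => ?_).weaken ?_
        le_rfl
      · simp only [RExpr.eval, ht.reg_θ]; norm_num
      · rintro _ rfl
        have hk : (2 : ℝ) ^ (k + 1) / 2 = 2 ^ k := by rw [pow_succ]; ring
        have := h.halve hD.le hθ
        rw [hk] at this
        exact ⟨s, n, acc, by simp [Mem.set, hk], this⟩
    · have hk : (2 : ℝ) ^ (m + 1) / 2 = 2 ^ m := by rw [pow_succ]; ring
      rw [hk]
      exact ⟨[], A.e, 0, by simp, PassInv.init hD.le hl (by positivity) hWm⟩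
    · rintro _ ⟨⟨k, s, e, acc, rfl, h⟩, hlt⟩
      have hk : k = 0 := by
        by_contra hk
        obtain ⟨k, rfl⟩ := Nat.exists_eq_succ_of_ne_zero hk
        apply hlt
        have hk : (2 : ℝ) ^ (k + 1) / 2 = 2 ^ k := by rw [pow_succ]; ring
        simp only [Nat.succ_eq_add_one, hk]
        exact one_le_pow₀ (by norm_num)
      subst hk
      rw [pow_zero] at h
      exact ⟨s, e, _, acc, rfl, h.nodup, h.suitable⟩
    · gcongr
  refine ((hoare_setReg (v := 0) (by norm_num) fun t ht => by simp [RExpr.eval]).seq (U :=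
    1 + (N * 2 + 1 + ((N + 1) * (n * 7 + 4) + 1))) ?_).weaken (fun _ h => h) (by ring_nf; omega)
  rintro _ rfl
  refine (hoare_setReg (v := 1) (by norm_num) fun t ht => by simp [RExpr.eval]).seq ?_
  rintro _ rfl
  refine (double _ (by simp [Mem.set])).seq ?_
  rintro _ ⟨m, hm, rfl, hWm⟩
  exact halve m hm hWm

end SSC

end

noncomputable section

namespace SSC

/-! ### The list program -/

open RAM

variable {n : ℕ} (I : Items n)

namespace RAM

/-- Compute the total absolute weight, the total cost and the least positive cost, and list the
items of cost zero. -/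
def gather : Program :=
  forItems (.seq
    (.cond weightNonneg (setReg 3 (.add (reg 3) (entry 2))) (setReg 3 (.sub (reg 3) (entry 2))))
    (.seq (setReg 4 (.add (reg 4) (entry 1)))
      (.cond (.realLe (entry 1) (.const 0)) appendItem
        (.cond (.conj (.neg (.realLe (reg 5) (.const 0))) (.realLe (reg 5) (entry 1))) .nop
          (setReg 5 (entry 1))))))

/-- Two passes for every budget, with doubling budgets. -/
def phases : Program :=
  .loop (.neg (.realLe (reg 4) (reg 5)))
    (.seq (pass true) (.seq (pass false) (setReg 5 (.add (reg 5) (reg 5)))))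

/-- Append all remaining items. -/
def appendRest : Program := forItems (.cond unlisted appendItem .nop)

def listProgram : Program := .seq gather (.seq phases appendRest)

end RAM

/-- Invariant of the first loop over the items. -/
structure InitInv (k : ℕ) (A : Mem n) : Prop where
  idx : A.e = k
  nodup : A.lst.Nodup
  mem_iff : ∀ i : Fin n, i ∈ A.lst ↔ (i : ℕ) < k ∧ I.c i ≤ 0
  weight : A.W = ∑ i : Fin n, if (i : ℕ) < k then |(I.w i : ℝ)| else 0
  total : A.tot = ∑ i : Fin n, if (i : ℕ) < k then I.c i else 0
  least : ∀ i : Fin n, (i : ℕ) < k → I.c i ≤ 0 ∨ 0 < A.D ∧ A.D ≤ I.c i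
  attained : A.D = 0 ∨ ∃ i, A.D = I.c i

theorem sum_lt_succ (f : Fin n → ℝ) (i : Fin n) :
    ∑ j : Fin n, (if (j : ℕ) < i + 1 then f j else 0) =
      ∑ j : Fin n, (if (j : ℕ) < i then f j else 0) + f i := by
  have : f i = ∑ j, if j = i then f j else 0 := by simp
  rw [this, ← Finset.sum_add_distrib]
  refine Finset.sum_congr rfl fun j _ => ?_
  by_cases hj : j = i
  · subst hj; simp
  · have hne : (j : ℕ) ≠ i := fun h => hj (Fin.ext h)
    have : (j : ℕ) < i + 1 ↔ (j : ℕ) < i := by omega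
    simp [hj, this]

/-! ### Gathering, budget phases and completion of the list -/

variable {I} {A : Mem n}

theorem hoare_gather :
    Hoare I gather ⟨[], 0, 0, 0, 0, 0, 0⟩ (InitInv I n) (n * 9 + 2) := by
  refine hoare_forItems (T := 7) ?_ (fun k A h => h.idx) ?_
  · constructor <;> simp
  · intro i A h hi
    have step1 : Hoare I (.cond weightNonneg (setReg 3 (.add (reg 3) (entry 2)))
        (setReg 3 (.sub (reg 3) (entry 2)))) A (· = A.set 3 (A.W + |(I.w i : ℝ)|)) 2 := by
      refine Hoare.cond (T := 1) (fun t ht => ht.weightNonneg_iff hi) ?_ ?_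
      · intro hw
        have : (0 : ℝ) ≤ I.w i := by exact_mod_cast hw
        refine hoare_setReg (by norm_num) fun t ht => ?_
        simp only [RExpr.eval, ht.reg_W, ht.entry_w hi, abs_of_nonneg this]
      · intro hw
        have : (I.w i : ℝ) < 0 := by exact_mod_cast not_le.1 hw
        refine hoare_setReg (by norm_num) fun t ht => ?_
        simp only [RExpr.eval, ht.reg_W, ht.entry_w hi, abs_of_neg this, sub_eq_add_neg]
    refine step1.seq (U := 5) ?_
    rintro _ rfl
    refine (hoare_setReg (v := A.tot + I.c i) (by norm_num) fun t ht => ?_).seq (U := 4) ?_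
    · simp only [RExpr.eval, ht.reg_tot, ht.entry_c (i := i) hi]
      simp [Mem.set]
    rintro _ rfl
    have hW : A.W + |(I.w i : ℝ)| = ∑ j : Fin n, if (j : ℕ) < i + 1 then |(I.w j : ℝ)| else 0 := by
      rw [h.weight, sum_lt_succ]
    have htot : A.tot + I.c i = ∑ j : Fin n, if (j : ℕ) < i + 1 then I.c j else 0 := by
      rw [h.total, sum_lt_succ]
    have split : ∀ j : Fin n, (j : ℕ) < i + 1 → (j : ℕ) < i ∨ j = i := fun j hj => by
      rcases Nat.lt_succ_iff_lt_or_eq.1 hj with h | h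
      · exact Or.inl h
      · exact Or.inr (Fin.ext h)
    have hnew : i ∉ A.lst := fun hm => lt_irrefl _ ((h.mem_iff i).1 hm).1
    refine Hoare.cond (T := 3) (φ := I.c i ≤ 0) (fun t ht => ?_) ?_ ?_
    · simp only [Test.Holds, RExpr.eval, ht.entry_c (i := i) hi, Rat.cast_zero]
    · intro hc
      refine (hoare_appendItem (A := (A.set 3 (A.W + |(I.w i : ℝ)|)).set 4 (A.tot + I.c i))
        (i := i) hi).weaken ?_ le_rfl
      rintro _ rfl
      refine ⟨hi, ⟨rfl, ?_, fun j => ?_, hW, htot, fun j hj => ?_, h.attained⟩⟩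
      · exact h.nodup.append (List.nodup_singleton i) (by simpa using hnew)
      · simp only [Mem.set, List.mem_append, List.mem_singleton, h.mem_iff]
        constructor
        · rintro (⟨h1, h2⟩ | rfl)
          · exact ⟨by omega, h2⟩
          · exact ⟨by omega, hc⟩
        · rintro ⟨h1, h2⟩
          exact (split j h1).imp_left fun h => ⟨h, h2⟩
      · rcases split j hj with hj | rfl
        · exact h.least j hj
        · exact Or.inl hc
    · intro hc
      have hmem : ∀ j : Fin n, j ∈ A.lst ↔ (j : ℕ) < i + 1 ∧ I.c j ≤ 0 := by
        intro j
        rw [h.mem_iff]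
        constructor
        · rintro ⟨h1, h2⟩
          exact ⟨by omega, h2⟩
        · rintro ⟨h1, h2⟩
          rcases split j h1 with h1 | rfl
          · exact ⟨h1, h2⟩
          · exact absurd h2 hc
      refine (Hoare.cond (T := 1) (φ := 0 < A.D ∧ A.D ≤ I.c i) (fun t ht => ?_) ?_ ?_).weaken
        (fun _ h => h) (by norm_num)
      · simp only [Test.Holds, RExpr.eval, ht.entry_c (i := i) hi, ht.reg_D, Rat.cast_zero]
        simp [Mem.set]
      · intro hD
        refine Hoare.nop ⟨hi, ⟨rfl, h.nodup, hmem, hW, htot, fun j hj => ?_, h.attained⟩⟩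
        rcases split j hj with hj | rfl
        · exact h.least j hj
        · exact Or.inr hD
      · intro hD
        refine (hoare_setReg (v := I.c i) (by norm_num) fun t ht => ?_).weaken ?_ le_rfl
        · simp only [ht.entry_c (i := i) hi]
        · rintro _ rfl
          refine ⟨hi, ⟨rfl, h.nodup, hmem, hW, htot, fun j hj => ?_, Or.inr ⟨i, rfl⟩⟩⟩
          change I.c j ≤ 0 ∨ 0 < I.c i ∧ I.c i ≤ I.c j
          rcases split j hj with hj | rfl
          · refine (h.least j hj).imp_right fun hj => ⟨not_le.1 hc, ?_⟩
            rw [not_and, not_le] at hD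
            exact (hD hj.1).le.trans hj.2
          · exact Or.inr ⟨not_le.1 hc, le_rfl⟩

variable (I) in
/-- Invariant of the loop over the budgets, with at most `k` more budgets to come. -/
structure PhaseInv (k : ℕ) (A : Mem n) : Prop where
  nodup : A.lst.Nodup
  weight : A.W = I.absWeight
  total : A.tot = ∑ i, I.c i
  competitive : ∃ D, 0 < D ∧ Competitive I D A.lst ∧
    (A.D = D ∧ A.tot ≤ D * 2 ^ k ∨ A.tot ≤ A.D ∧ A.tot ≤ D)

theorem InitInv.phaseInv (h : InitInv I n A) {M : ℕ}
    (hM : ∀ i, 0 < I.c i → ∑ j, I.c j ≤ I.c i * 2 ^ M) : PhaseInv I M A where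
  nodup := h.nodup
  weight := by rw [h.weight]; simp [Items.absWeight]
  total := by rw [h.total]; simp
  competitive := by
    have hmem : ∀ i, i ∈ A.lst ↔ I.c i ≤ 0 := fun i => by simp [h.mem_iff]
    have htot : A.tot = ∑ i, I.c i := by rw [h.total]; simp
    by_cases hD : 0 < A.D
    · refine ⟨A.D, hD, Competitive.init I hD (fun i => (h.least i i.2).imp_right And.right) hmem,
        Or.inl ⟨rfl, ?_⟩⟩
      rcases h.attained with h0 | ⟨i, hi⟩
      · exact absurd hD (by rw [h0]; exact lt_irrefl _)
      · rw [htot, hi]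
        exact hM i (hi ▸ hD)
    · have hc : ∀ i, I.c i ≤ 0 := fun i => (h.least i i.2).resolve_right fun h => hD h.1
      have h0 : A.tot ≤ 0 := by rw [htot]; exact Finset.sum_nonpos fun i _ => hc i
      -- When all costs are zero there is no least positive cost: any positive budget works, and the
      -- loop over budgets is never entered.
      refine ⟨1, one_pos, Competitive.init I one_pos (fun i => Or.inl (hc i)) hmem,
        Or.inr ⟨?_, by linarith⟩⟩
      rcases h.attained with hD' | ⟨i, hi⟩
      · rwa [hD']
      · rw [hi]
        exact h0.trans (I.c_nonneg i)

theorem hoare_phases {N M : ℕ} (hN : I.absWeight ≤ 2 ^ N) (h : PhaseInv I M A) :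
    Hoare I phases A (fun A' => A'.lst.Nodup ∧ ∃ D, 0 < D ∧ Competitive I D A'.lst ∧
      ∑ i, I.c i ≤ D) (M * (2 * ((N + 1) * (n * 7 + 8)) + 2) + 1) := by
  refine (Hoare.loop (φ := fun A => A.D < A.tot) (J := PhaseInv I)
    (T := 2 * ((N + 1) * (n * 7 + 8)) + 1) ?_ ?_ M A h).weaken ?_ le_rfl
  · intro A t ht
    simp only [Test.Holds, ht.reg_tot, ht.reg_D, not_le]
  · intro k A h hlt
    obtain ⟨D, hD, hcomp, ⟨hAD, htot⟩ | ⟨hle, -⟩⟩ := h.competitive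
    swap
    · exact absurd hlt (not_lt.2 hle)
    have hk : k ≠ 0 := by
      rintro rfl
      rw [pow_zero, mul_one] at htot
      linarith
    obtain ⟨k, rfl⟩ := Nat.exists_eq_succ_of_ne_zero hk
    refine ⟨k, rfl, ?_⟩
    subst hAD
    refine ((hoare_pass true hD h.weight h.nodup hN).seq
      (U := (N + 1) * (n * 7 + 8) + 1) ?_).weaken (fun _ h => h) (by omega)
    rintro _ ⟨s, e, θ, acc, rfl, hsn, hs⟩
    refine (hoare_pass false (A := { A with lst := A.lst ++ s, e := e, θ := θ, acc := acc })
      hD h.weight hsn hN).seq ?_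
    rintro _ ⟨r, e, θ, acc, rfl, hrn, hr⟩
    refine (hoare_setReg (v := A.D + A.D) (by norm_num) fun t ht => ?_).weaken ?_ le_rfl
    · simp only [RExpr.eval, ht.reg_D]
    · rintro _ rfl
      refine ⟨hrn, h.weight, h.total, A.D + A.D, by linarith,
        hcomp.phase I hD hsn.of_append_right hs hrn.of_append_right hr, Or.inl ⟨rfl, ?_⟩⟩
      refine htot.trans (le_of_eq ?_)
      rw [pow_succ]
      ring
  · rintro A ⟨⟨k, h⟩, hle⟩
    obtain ⟨D, hD, hcomp, h'⟩ := h.competitive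
    refine ⟨h.nodup, D, hD, hcomp, ?_⟩
    rw [← h.total]
    rcases h' with ⟨hAD, -⟩ | ⟨-, hle⟩
    · rw [← hAD]
      exact not_lt.1 hle
    · exact hle

theorem hoare_appendRest (h : A.lst.Nodup) :
    Hoare I appendRest A (fun A' => ∃ r, A'.lst = A.lst ++ r ∧ A'.lst.Nodup ∧ ∀ i, i ∈ A'.lst)
      (n * 6 + 2) := by
  refine (hoare_forItems (T := 4) (J := fun k A' => A'.e = k ∧ ∃ r, A'.lst = A.lst ++ r ∧
    A'.lst.Nodup ∧ ∀ i : Fin n, (i : ℕ) < k → i ∈ A'.lst) ⟨rfl, [], by simp, h, by simp⟩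
    (fun k A h => h.1) ?_).weaken ?_ le_rfl
  · rintro i A' ⟨hi, r, hr, hn, hall⟩ -
    refine Hoare.cond (fun t ht => ht.unlisted_iff hi) ?_ ?_
    · intro hni
      refine (hoare_appendItem hi).weaken ?_ le_rfl
      rintro _ rfl
      refine ⟨hi, rfl, r ++ [i], by simp [hr],
        hn.append (List.nodup_singleton i) (by simpa using hni), fun j hj => ?_⟩
      rcases Nat.lt_succ_iff_lt_or_eq.1 hj with hj | hj
      · exact List.mem_append_left _ (hall j hj)
      · simp [Fin.ext hj]
    · intro hni
      refine (Hoare.nop ⟨hi, rfl, r, hr, hn, fun j hj => ?_⟩).weaken (fun _ h => h) (by norm_num)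
      rcases Nat.lt_succ_iff_lt_or_eq.1 hj with hj | hj
      · exact hall j hj
      · rw [Fin.ext hj]
        exact not_not.1 hni
  · rintro A' ⟨-, r, hr, hn, hall⟩
    exact ⟨r, hr, hn, fun i => hall i i.2⟩

theorem hoare_listProgram {N M : ℕ} (hN : I.absWeight ≤ 2 ^ N)
    (hM : ∀ i, 0 < I.c i → ∑ j, I.c j ≤ I.c i * 2 ^ M) :
    Hoare I listProgram ⟨[], 0, 0, 0, 0, 0, 0⟩ (fun A => ∃ l r D, A.lst = l ++ r ∧ A.lst.Nodup ∧
      (∀ i, i ∈ A.lst) ∧ 0 ≤ D ∧ Competitive I D l ∧ (r.map I.c).sum ≤ D)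
      (40 * (n + 1) * ((M + 1) * (N + 1))) := by
  refine (hoare_gather.seq (U := (M * (2 * ((N + 1) * (n * 7 + 8)) + 2) + 1) + (n * 6 + 2))
    ?_).weaken (fun _ h => h) ?_
  · intro A hA
    refine (hoare_phases hN (hA.phaseInv hM)).seq ?_
    rintro A ⟨hn, D, hD, hcomp, htot⟩
    refine (hoare_appendRest hn).weaken ?_ le_rfl
    rintro A' ⟨r, hr, hn', hall⟩
    refine ⟨A.lst, r, D, hr, hn', hall, hD.le, hcomp, le_trans ?_ htot⟩
    rw [← List.sum_toFinset I.c (hr ▸ hn').of_append_right]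
    exact Finset.sum_le_sum_of_subset_of_nonneg (Finset.subset_univ _) fun i _ _ => I.c_nonneg i
  · have h1 : n + 1 ≤ (N + 1) * (n + 1) := Nat.le_mul_of_pos_left _ (by omega)
    set a := (N + 1) * (n + 1) with ha
    have h2 : (N + 1) * (n * 7 + 8) ≤ 8 * a := by rw [ha]; nlinarith
    have h3 : M * (2 * ((N + 1) * (n * 7 + 8)) + 2) ≤ M * (18 * a) :=
      Nat.mul_le_mul_left M (by omega)
    have h4 : 40 * (n + 1) * ((M + 1) * (N + 1)) = 40 * (M * a) + 40 * a := by rw [ha]; ring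
    have h5 : M * (18 * a) = 18 * (M * a) := by ring
    omega

/-! ### Numbers of scales and budgets as logarithms -/

theorem le_two_pow_ceil_logb (x : ℝ) : x ≤ 2 ^ ⌈Real.logb 2 x⌉₊ := by
  rcases le_or_gt x 0 with hx | hx
  · exact hx.trans (by positivity)
  · calc x = 2 ^ Real.logb 2 x := (Real.rpow_logb (by norm_num) (by norm_num) hx).symm
      _ ≤ 2 ^ ((⌈Real.logb 2 x⌉₊ : ℕ) : ℝ) :=
        Real.rpow_le_rpow_of_exponent_le (by norm_num) (Nat.le_ceil _)
      _ = _ := Real.rpow_natCast _ _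

theorem ceil_logb_le {x y : ℝ} (hx : 0 ≤ x) (hxy : x ≤ y) (hy : 1 ≤ y) :
    (⌈Real.logb 2 x⌉₊ : ℝ) ≤ 2 * Real.log y + 1 := by
  have hly : 0 ≤ Real.log y := Real.log_nonneg hy
  rcases le_or_gt x 1 with h1 | h1
  · rw [Nat.ceil_eq_zero.2 (Real.logb_nonpos (by norm_num) hx h1)]
    simp only [Nat.cast_zero]
    linarith
  · have h2 : 0 ≤ Real.logb 2 x := Real.logb_nonneg (by norm_num) h1.le
    refine (Nat.ceil_lt_add_one h2).le.trans (add_le_add ?_ le_rfl)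
    rw [← Real.log_div_log, div_le_iff₀ (Real.log_pos (by norm_num))]
    have h3 : Real.log x ≤ Real.log y := Real.log_le_log (by linarith) hxy
    nlinarith [Real.log_two_gt_d9]

end SSC

end

theorem theorem1 :
    ∃ (P : SSC.RAM.Program) (C K : ℝ) (d : ℕ), ∀ (n : ℕ) (I : SSC.Items n),
      ∃ (σ : Equiv.Perm (Fin n)) (s : SSC.RAM.Store) (t : ℕ),
        SSC.RAM.Run P I.input s t ∧
        SSC.OutputIs s σ ∧
        (∀ Γ : ℝ, 1 ≤ Γ → (∀ i j, 0 < I.c j → I.c i ≤ Γ * I.c j) →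
          (t : ℝ) ≤ K * (n + 1) * Real.log (2 + n + ∑ i, |(I.w i : ℝ)| + Γ) ^ d) ∧
        ∀ (B : ℕ) (α : Fin (B + 1) → ℤ), SSC.IsThresholds I α →
          ∀ T : SSC.Policy n B, T.Correct I α →
            SSC.listExpectedCost I α σ ≤ C * T.expectedCost I := by
  -- The factor 2592 = 1296 · 2 comes from `Competitive.finish`; 960 = 40 · 6 · 4 combines the step
  -- bound with M + 1 ≤ 6 log Z and N + 1 ≤ 4 log Z.
  refine ⟨SSC.RAM.listProgram, 2592, 960, 2, fun n I => ?_⟩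
  set N := ⌈Real.logb 2 I.absWeight⌉₊
  set M := Finset.univ.sup fun i => ⌈Real.logb 2 ((∑ j, I.c j) / I.c i)⌉₊ with hMdef
  have hM : ∀ i, 0 < I.c i → ∑ j, I.c j ≤ I.c i * 2 ^ M := by
    intro i hi
    rw [← div_le_iff₀' hi]
    refine (SSC.le_two_pow_ceil_logb _).trans (pow_le_pow_right₀ (by norm_num) ?_)
    exact Finset.le_sup (f := fun i => ⌈Real.logb 2 ((∑ j, I.c j) / I.c i)⌉₊) (Finset.mem_univ i)
  obtain ⟨s, A, t, hrun, hrep, ⟨l, r, D, hlr, hn, hall, hD, hcomp, hr⟩, ht⟩ :=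
    SSC.hoare_listProgram (SSC.le_two_pow_ceil_logb I.absWeight) hM I.input (SSC.rep_input I)
  have hlen : A.lst.length = n := by
    have h1 : A.lst.toFinset = Finset.univ := by ext i; simp [hall i]
    rw [← List.toFinset_card_of_nodup hn, h1, Finset.card_univ, Fintype.card_fin]
  have hinj : Function.Injective fun k : Fin n => A.lst[(k : ℕ)] := by
    intro i j hij
    exact Fin.ext ((hn.getElem_inj_iff).1 hij)
  refine ⟨Equiv.ofBijective _ (Finite.injective_iff_bijective.1 hinj), s, t, hrun, ?_, ?_, ?_⟩
  · intro k
    rw [hrep.out k (by omega)]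
    rfl
  · intro Γ hΓ hratio
    have hW0 : 0 ≤ ∑ i, |(I.w i : ℝ)| := Finset.sum_nonneg fun i _ => abs_nonneg _
    have hn0 : (0 : ℝ) ≤ n := Nat.cast_nonneg n
    set Z := 2 + (n : ℝ) + ∑ i, |(I.w i : ℝ)| + Γ with hZ
    have hZ3 : 3 ≤ Z := by linarith
    have hlog : 1 ≤ Real.log Z := by
      rw [Real.le_log_iff_exp_le (by linarith)]
      linarith [Real.exp_one_lt_d9]
    have hN : (N : ℝ) ≤ 2 * Real.log Z + 1 :=
      SSC.ceil_logb_le hW0 (by change ∑ i, |(I.w i : ℝ)| ≤ Z; linarith) (by linarith)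
    have hMZ : (M : ℝ) ≤ 4 * Real.log Z + 1 := by
      obtain hM0 | ⟨i, hi⟩ : M = 0 ∨ ∃ i, M = ⌈Real.logb 2 ((∑ j, I.c j) / I.c i)⌉₊ := by
        rcases isEmpty_or_nonempty (Fin n) with h | h
        · left
          rw [hMdef, Finset.univ_eq_empty, Finset.sup_empty]
          rfl
        · right
          obtain ⟨i, -, hi⟩ := Finset.exists_mem_eq_sup Finset.univ Finset.univ_nonempty
            fun i => ⌈Real.logb 2 ((∑ j, I.c j) / I.c i)⌉₊
          exact ⟨i, hi⟩
      · rw [hM0, Nat.cast_zero]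
        linarith
      -- The total cost is at most nΓ times any positive cost. For a free item the quotient is 0 by
      -- convention.
      · have hle : (∑ j, I.c j) / I.c i ≤ Z ^ 2 := by
          rcases (I.c_nonneg i).eq_or_lt with h0 | h0
          · rw [← h0, div_zero]
            positivity
          · rw [div_le_iff₀ h0]
            have hsum : ∑ j, I.c j ≤ n * (Γ * I.c i) := by
              have := Finset.sum_le_card_nsmul Finset.univ I.c (Γ * I.c i)
                fun j _ => hratio j i h0
              simpa using this
            have : n * Γ ≤ Z ^ 2 := by
              rw [pow_two]
              exact mul_le_mul (by linarith) (by linarith) (by linarith) (by linarith)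
            nlinarith
        have := SSC.ceil_logb_le (div_nonneg (Finset.sum_nonneg fun j _ => I.c_nonneg j)
          (I.c_nonneg i)) hle (one_le_pow₀ (by linarith))
        rw [Real.log_pow, ← hi] at this
        push_cast at this
        linarith
    have ht' : (t : ℝ) ≤ 40 * (n + 1) * ((M + 1) * (N + 1)) := by exact_mod_cast ht
    have hMN : ((M : ℝ) + 1) * (N + 1) ≤ (6 * Real.log Z) * (4 * Real.log Z) :=
      mul_le_mul (by linarith) (by linarith) (by positivity) (by linarith)
    calc (t : ℝ) ≤ 40 * (n + 1) * ((M + 1) * (N + 1)) := ht'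
      _ ≤ 40 * (n + 1) * ((6 * Real.log Z) * (4 * Real.log Z)) :=
        mul_le_mul_of_nonneg_left hMN (by positivity)
      _ = 960 * (n + 1) * Real.log Z ^ 2 := by ring
  · intro B α _ T hT
    have h := hcomp.finish I α hD hr hT
    rw [← hlr] at h
    refine le_trans (I.expect_mono fun x => le_of_eq ?_) h
    exact SSC.listCost_eq_lcost I α A.lst hlen _ (fun k => rfl) x
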